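/- Identify $\mathfrak{so}(3)$ and $\mathfrak{so}(3)^*$ with $\mathbb{R}^3$ by the hat map and the Euclidean inner product. Let $\mathrm{Ad}^*_g$ and $\mathrm{ad}^*_\xi$ be the duals of $\mathrm{Ad}_g$ and $\mathrm{ad}_\xi$, so that $\langle \mathrm{ad}^*_\xi\mu,\zeta\rangle=\langle\mu,[\xi,\zeta]\rangle$. Left-trivialise $T^*SO(3)\cong SO(3)\times\mathfrak{so}(3)^*$ and $TSO(3)\cong SO(3)\times\mathfrak{so}(3)$, and let $\Omega_c=-d\theta$ be the canonical symplectic form, $\theta$ being the tautological one-form; that is, $\Omega_c(g,m)((\xi_1,\rho_1),(\xi_2,\rho_2))=\langle m,[\xi_1,\xi_2]\rangle+\langle\rho_2,\xi_1\rangle-\langle\rho_1,\xi_2\rangle$. Let $\mu\in\mathfrak{so}(3)^*$, $\mu\neq 0$. Let $\mathfrak{so}(3)_\mu=\{\xi:\mathrm{ad}^*_\xi\mu=0\}$, with orthogonal complement $\mathfrak{so}(3)_\mu^\perp$, and let $\xi^\mu$ be the $\mathfrak{so}(3)_\mu$-component of $\xi$. Embed $\mathfrak{so}(3)_\mu^*$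 in $\mathfrak{so}(3)^*$ as the annihilator of $\mathfrak{so}(3)_\mu^\perp$ and identify it with $\mathbb{R}$ by $s\leftrightarrow s\,\mu/\|\mu\|$, which gives a meaning to $\nu>-\|\mu\|$ for $\nu\in\mathfrak{so}(3)_\mu^*$. Let $T_\mu\mathcal{O}_\mu=\{\mathrm{ad}^*_\eta\mu:\eta\in\mathfrak{so}(3)_\mu^\perp\}$ be the tangent space at $\mu$ of the coadjoint orbit. On $SO(3)\times\mathfrak{so}(3)_\mu^*\times T_\mu\mathcal{O}_\mu$ let $$\Omega_Y(g,\nu,\rho)\big((\xi_1,\dot\nu_1,\mathrm{ad}^*_{\zeta_1}\mu),(\xi_2,\dot\nu_2,\mathrm{ad}^*_{\zeta_2}\mu)\big)=\langle\mu+\nu,[\xi_1,\xi_2]\rangle+\langle\dot\nu_2,\xi_1^\mu\rangle-\langle\dot\nu_1,\xi_2^\mu\rangle-\langle\mu,[\zeta_1,\zeta_2]\rangle\qquad(\zeta_1,\zeta_2\in\mathfrak{so}(3)_\mu^\perp).$$ For $\eta\in\mathfrak{so}(3)_\mu^\perp$ let $$\Phi(g,\nu,\mathrm{ad}^*_\eta\mu)=\big(gF(\nu,\eta)^{-1},\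 \mathrm{Ad}^*_{F(\nu,\eta)^{-1}}(\mu+\nu)\big),\qquad F(\nu,\eta)=\exp\Big(2\arcsin\Big(\tfrac12\|\eta\|\sqrt{\tfrac{\|\mu\|}{\|\mu+\nu\|}}\Big)\frac{\eta}{\|\eta\|}\Big),\quad F(\nu,0)=e,$$ with domain $SO(3)\times U$, where $$U=\Big\{(\nu,\mathrm{ad}^*_\eta\mu):\ \eta\in\mathfrak{so}(3)_\mu^\perp,\ \nu>-\|\mu\|,\ \|\eta\|<2\sqrt{\|\mu+\nu\|/\|\mu\|}\Big\}.$$ **Theorem.** $SO(3)\times U$ is an open neighbourhood of $SO(3)\times\{(0,0)\}$, and $\Phi$ is a symplectic tube on it: $\Phi(e,0,0)=(e,\mu)$; $\Phi$ is equivariant for the left actions $h(g,\nu,\rho)=(hg,\nu,\rho)$ and $h(g,m)=(hg,m)$; $\Phi$ is a diffeomorphism from $SO(3)\times U$ onto an open subset of $SO(3)\times\mathfrak{so}(3)^*$; and $\Phi^*\Omega_c=\Omega_Y$. Moreover $\Omega_Y$ is nondegenerate on $SO(3)\times U$, and $J_Y(g,\nu,\rho)=\mathrm{Ad}^*_{g^{-1}}(\mu+\nu)$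 satisfies $\Omega_Y(X_\xi,\cdot)=d\langle J_Y,\xi\rangle$ there for every $\xi\in\mathfrak{so}(3)$, where $X_\xi$ is the infinitesimal generator of the left action. -/

import Mathlib

open scoped Matrix ContDiff Topology

noncomputable section

/-- Euclidean three-space. It carries `so(3)` (through the hat map) and, by the Euclidean inner
product, also the dual `so(3)^*`. -/
abbrev E3 : Type := EuclideanSpace ℝ (Fin 3)

/-- Real `3 × 3` matrices. -/
abbrev M3 : Type := Matrix (Fin 3) (Fin 3) ℝ

/-- Real `3 × 3` matrices, as a normed space of arrays. -/
abbrev MatSpace : Type := Fin 3 → Fin 3 → ℝ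

/-- The Lie group `SO(3)`. -/
abbrev SO3 : Type := Matrix.specialOrthogonalGroup (Fin 3) ℝ

namespace SO3

/-! ### The Lie algebra and its dual -/

/-- The hat map `ℝ³ → so(3)`. -/
def hat : E3 →ₗ[ℝ] M3 where
  toFun v := !![0, -v 2, v 1; v 2, 0, -v 0; -v 1, v 0, 0]
  map_add' v w := by
    ext i j; fin_cases i <;> fin_cases j <;> simp <;> ring
  map_smul' c v := by
    ext i j; fin_cases i <;> fin_cases j <;> simp

/-- The vector in `ℝ³` that corresponds to the skew-symmetric part of a matrix; on
skew-symmetric matrices it is the inverse of the hat map. -/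
def vee : M3 →ₗ[ℝ] E3 where
  toFun B := !₂[(B 2 1 - B 1 2) / 2, (B 0 2 - B 2 0) / 2, (B 1 0 - B 0 1) / 2]
  map_add' B C := by
    ext i; fin_cases i <;> simp <;> ring
  map_smul' c B := by
    ext i; fin_cases i <;> simp <;> ring

theorem vee_hat (v : E3) : vee (hat v) = v := by
  ext i; fin_cases i <;> simp [vee, hat]

theorem hat_vee (B : M3) (hB : Bᵀ = -B) : hat (vee B) = B := by
  have h : ∀ i j, B j i = -B i j := fun i j => congrFun (congrFun hB i) j
  have h00 := h 0 0
  have h11 := h 1 1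
  have h22 := h 2 2
  have h01 := h 0 1
  have h02 := h 0 2
  have h12 := h 1 2
  ext i j; fin_cases i <;> fin_cases j <;> simp [vee, hat] <;> linarith

theorem hat_transpose (v : E3) : (hat v)ᵀ = -hat v := by
  ext i j; fin_cases i <;> fin_cases j <;> simp [hat]

/-- The Lie bracket of `so(3)`, that is, the commutator of matrices. -/
def bracket (x y : E3) : E3 := vee (hat x * hat y - hat y * hat x)

/-- The bracket is the cross product. -/
theorem bracket_eq (x y : E3) :
    bracket x y = !₂[x 1 * y 2 - x 2 * y 1, x 2 * y 0 - x 0 * y 2, x 0 * y 1 - x 1 * y 0] := by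
  ext i; fin_cases i <;>
    simp [bracket, vee, hat] <;> ring

/-- The infinitesimal adjoint action `ad_ξ = [ξ, ·]`. -/
def ad (ξ : E3) : E3 →ₗ[ℝ] E3 where
  toFun ζ := bracket ξ ζ
  map_add' x y := by
    simp only [bracket]; rw [← map_add vee]; congr 1; simp only [map_add, mul_add, add_mul]; abel
  map_smul' c x := by simp [bracket, smul_sub]

/-- The dual `ad*_ξ` of `ad_ξ`, so that `⟨ad*_ξ μ, ζ⟩ = ⟨μ, [ξ, ζ]⟩`. -/
def adStar (ξ : E3) : E3 →ₗ[ℝ] E3 := LinearMap.adjoint (ad ξ)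

theorem adStar_eq (ξ μ : E3) : adStar ξ μ = bracket μ ξ := by
  refine ext_inner_right ℝ fun ζ => ?_
  rw [adStar, LinearMap.adjoint_inner_left]
  change inner ℝ μ (bracket ξ ζ) = _
  simp only [bracket_eq, PiLp.inner_apply, Fin.sum_univ_three]
  simp
  ring

/-- The adjoint action of `SO(3)`: `Ad_g ξ = g ξ g⁻¹`. -/
def Ad (g : SO3) : E3 →ₗ[ℝ] E3 where
  toFun ξ := vee ((g : M3) * hat ξ * ((g⁻¹ : SO3) : M3))
  map_add' x y := by simp [mul_add, add_mul]
  map_smul' c x := by simp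

/-- The dual `Ad*_g` of `Ad_g`. The coadjoint action of `g` is `Ad*_{g⁻¹}`. -/
def AdStar (g : SO3) : E3 →ₗ[ℝ] E3 := LinearMap.adjoint (Ad g)

theorem hat_Ad (g : SO3) (ξ : E3) :
    hat (Ad g ξ) = (g : M3) * hat ξ * ((g⁻¹ : SO3) : M3) := by
  refine hat_vee _ ?_
  have h : ((g⁻¹ : SO3) : M3) = (g : M3)ᵀ := rfl
  rw [h, Matrix.transpose_mul, Matrix.transpose_mul, hat_transpose, Matrix.transpose_transpose]
  simp [Matrix.mul_assoc]

/-! ### Exponential map -/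

theorem exp_hat_mem (v : E3) :
    NormedSpace.exp (hat v) ∈ Matrix.specialOrthogonalGroup (Fin 3) ℝ := by
  have horth : ∀ w : E3, NormedSpace.exp (hat w) ∈ Matrix.orthogonalGroup (Fin 3) ℝ := by
    intro w
    rw [Matrix.mem_orthogonalGroup_iff, ← Matrix.exp_transpose, hat_transpose,
      ← Matrix.exp_add_of_commute _ _ (show Commute (hat w) (-hat w) by
        simp [Commute, SemiconjBy])]
    simp
  rw [Matrix.mem_specialOrthogonalGroup_iff]
  refine ⟨horth v, ?_⟩
  have h2 : hat v = hat ((1 / 2 : ℝ) • v) + hat ((1 / 2 : ℝ) • v) := by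
    rw [← map_add, ← add_smul]; norm_num
  have h3 := (Matrix.mem_orthogonalGroup_iff (Fin 3) ℝ).1 (horth ((1 / 2 : ℝ) • v))
  have h4 := congrArg Matrix.det h3
  rw [Matrix.det_mul, Matrix.det_transpose, Matrix.det_one] at h4
  rw [h2, Matrix.exp_add_of_commute _ _ (Commute.refl _), Matrix.det_mul, h4]

/-- The exponential map `so(3) → SO(3)` (matrix exponential). -/
def expSO3 (v : E3) : SO3 := ⟨NormedSpace.exp (hat v), exp_hat_mem v⟩

/-! ### Isotropy algebra, its complement, tangent space of the coadjoint orbit -/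

/-- The linear map `η ↦ ad*_η μ`. -/
def orbitMap (μ : E3) : E3 →ₗ[ℝ] E3 where
  toFun η := adStar η μ
  map_add' x y := by
    simp only [adStar_eq]; exact (ad μ).map_add x y
  map_smul' c x := by
    simp only [adStar_eq]; exact (ad μ).map_smul c x

/-- The isotropy algebra `so(3)_μ = {ξ : ad*_ξ μ = 0}`. The splitting
`so(3) = so(3)_μ ⊕ so(3)_μ^⊥` embeds its dual `so(3)_μ^*` in `so(3)^*` as the annihilator of
`so(3)_μ^⊥`; under the inner product this is the same subspace of `ℝ³`. -/
def isotropy (μ : E3) : Submodule ℝ E3 := LinearMap.ker (orbitMap μ)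

/-- The orthogonal complement `so(3)_μ^⊥`. -/
def isotropyPerp (μ : E3) : Submodule ℝ E3 := (isotropy μ)ᗮ

/-- The tangent space `T_μ O_μ = {ad*_η μ}` of the coadjoint orbit through `μ`. -/
def orbitTangent (μ : E3) : Submodule ℝ E3 := LinearMap.range (orbitMap μ)

/-- The inverse of `so(3)_μ^⊥ → T_μ O_μ`, `η ↦ ad*_η μ` (for `μ ≠ 0`). -/
def orbitInv (μ : E3) (ρ : orbitTangent μ) : E3 := (‖μ‖ ^ 2)⁻¹ • bracket ρ μ

theorem normSq_eq (μ : E3) : ‖μ‖ ^ 2 = μ 0 ^ 2 + μ 1 ^ 2 + μ 2 ^ 2 := by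
  simp [EuclideanSpace.norm_sq_eq, Fin.sum_univ_three]

theorem self_mem_isotropy (μ : E3) : μ ∈ isotropy μ := by
  change adStar μ μ = 0
  rw [adStar_eq, bracket, sub_self, map_zero]

theorem orbitInv_adStar (μ : E3) (hμ : μ ≠ 0) (η : E3) (hη : η ∈ isotropyPerp μ) :
    orbitInv μ ⟨adStar η μ, η, rfl⟩ = η := by
  have hp : inner ℝ μ η = 0 := (Submodule.mem_orthogonal _ _).1 hη μ (self_mem_isotropy μ)
  simp only [PiLp.inner_apply, Fin.sum_univ_three] at hp
  simp at hp
  have hn : ‖μ‖ ^ 2 ≠ 0 := by simpa using hμ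
  rw [orbitInv, inv_smul_eq_iff₀ hn, normSq_eq]
  simp only [adStar_eq, bracket_eq]
  ext i; fin_cases i <;> simp
  · linear_combination (-μ 0) * hp
  · linear_combination (-μ 1) * hp
  · linear_combination (-μ 2) * hp

theorem orbitInv_spec (μ : E3) (hμ : μ ≠ 0) (ρ : orbitTangent μ) :
    orbitInv μ ρ ∈ isotropyPerp μ ∧ adStar (orbitInv μ ρ) μ = ρ := by
  obtain ⟨ρ, ξ, rfl⟩ := ρ
  have hn : ‖μ‖ ^ 2 ≠ 0 := by simpa using hμ
  have key : adStar (orbitInv μ ⟨orbitMap μ ξ, ξ, rfl⟩) μ = orbitMap μ ξ := by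
    change adStar _ μ = adStar ξ μ
    rw [orbitInv, adStar_eq]
    have hb : bracket μ ((‖μ‖ ^ 2)⁻¹ • bracket (orbitMap μ ξ) μ) =
        (‖μ‖ ^ 2)⁻¹ • bracket μ (bracket (orbitMap μ ξ) μ) := by
      exact (ad μ).map_smul _ _
    rw [hb, inv_smul_eq_iff₀ hn, normSq_eq]
    change bracket μ (bracket (adStar ξ μ) μ) = _
    simp only [adStar_eq, bracket_eq]
    ext i; fin_cases i <;> simp <;> ring
  refine ⟨?_, key⟩
  rw [isotropyPerp, Submodule.mem_orthogonal]
  intro u hu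
  change adStar u μ = 0 at hu
  have h1 : inner ℝ u (bracket (orbitMap μ ξ) μ) = inner ℝ (orbitMap μ ξ) (adStar u μ) := by
    rw [adStar_eq]
    simp only [bracket_eq, PiLp.inner_apply, Fin.sum_univ_three]
    simp
    ring
  rw [orbitInv, inner_smul_right]
  change _ * inner ℝ u (bracket (orbitMap μ ξ) μ) = 0
  rw [h1, hu, inner_zero_right, mul_zero]

/-! ### Calculus on `SO(3) × V`

`SO(3)` is an embedded submanifold of the space of matrices, and its tangent space at `g` is
`{g ξ : ξ ∈ so(3)}`. Tangent vectors of `SO(3) × V` (`V` a normed space) are left-trivialised,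
that is, written as pairs `(ξ, w) ∈ so(3) × V`. -/

section Calculus

variable {V W : Type*} [NormedAddCommGroup V] [NormedSpace ℝ V]
  [NormedAddCommGroup W] [NormedSpace ℝ W]

/-- The embedding of `SO(3) × V` in the vector space `M₃(ℝ) × V`. -/
def emb (p : SO3 × V) : MatSpace × V := (Matrix.of.symm (p.1 : M3), p.2)

/-- The tangent vector of `M₃(ℝ) × V` at `p` with left-trivialisation `v`. -/
def embTangent (p : SO3 × V) (v : E3 × V) : MatSpace × V :=
  (Matrix.of.symm ((p.1 : M3) * hat v.1), v.2)

/-- Smoothness on a subset `S` of `SO(3) × V`: locally, the map extends to a smooth map of the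
ambient vector spaces. -/
def SmoothOn (f : SO3 × V → SO3 × W) (S : Set (SO3 × V)) : Prop :=
  ∀ p ∈ S, ∃ O : Set (MatSpace × V), IsOpen O ∧ emb p ∈ O ∧ ∃ F : MatSpace × V → MatSpace × W,
    ContDiffOn ℝ ∞ F O ∧ ∀ q ∈ S, emb q ∈ O → F (emb q) = emb (f q)

/-- The curve `c` in `SO(3) × V` is differentiable at time `0`, with left-trivialised velocity
`v`. -/
def HasVelocity (c : ℝ → SO3 × V) (v : E3 × V) : Prop :=
  HasDerivAt (fun t => emb (c t)) (embTangent (c 0) v) 0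

/-- `L` is the tangent map of `f` at `p`, in left-trivialisation. -/
def HasTangentMapAt (f : SO3 × V → SO3 × W) (p : SO3 × V) (L : E3 × V →ₗ[ℝ] E3 × W) : Prop :=
  ∀ (c : ℝ → SO3 × V) (v : E3 × V), c 0 = p → HasVelocity c v →
    HasVelocity (fun t => f (c t)) (L v)

/-- `f^* α = β` on `S`, for two-forms written in left-trivialisation. -/
def PullbackEqOn (f : SO3 × V → SO3 × W) (α : SO3 × W → E3 × W → E3 × W → ℝ)
    (β : SO3 × V → E3 × V → E3 × V → ℝ) (S : Set (SO3 × V)) : Prop :=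
  ∀ p ∈ S, ∃ L : E3 × V →ₗ[ℝ] E3 × W, HasTangentMapAt f p L ∧
    ∀ v w, α (f p) (L v) (L w) = β p v w

/-- The exterior derivative of a one-form on a normed space. -/
def dOneForm (θ : V → V →L[ℝ] ℝ) (x v w : V) : ℝ :=
  extDeriv (fun y => ContinuousAlternatingMap.ofSubsingleton ℝ V ℝ (0 : Fin 1) (θ y)) x ![v, w]

theorem dOneForm_eq (θ : V → V →L[ℝ] ℝ) (x v w : V) (hθ : DifferentiableAt ℝ θ x) :
    dOneForm θ x v w = fderiv ℝ (fun y => θ y w) x v - fderiv ℝ (fun y => θ y v) x w := by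
  have h : DifferentiableAt ℝ
      (fun y => ContinuousAlternatingMap.ofSubsingleton ℝ V ℝ (0 : Fin 1) (θ y)) x :=
    (ContinuousAlternatingMap.ofSubsingletonLIE (𝕜 := ℝ) (E := V) (F := ℝ)
      (0 : Fin 1)).toContinuousLinearEquiv.differentiableAt.comp x hθ
  rw [dOneForm, extDeriv_apply h, Fin.sum_univ_two]
  simp [Fin.removeNth, sub_eq_add_neg]

end Calculus

/-! ### The canonical symplectic form of `T^*SO(3)` -/

/-- The bilinear map `(A, B) ↦ vee (Aᵀ B)`. -/
def leftVee : MatSpace →ₗ[ℝ] MatSpace →ₗ[ℝ] E3 :=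
  LinearMap.mk₂ ℝ (fun A B => vee ((Matrix.of A)ᵀ * Matrix.of B))
    (fun A A' B => by rw [← Matrix.of_add_of, Matrix.transpose_add, add_mul, map_add])
    (fun c A B => by rw [← Matrix.smul_of, Matrix.transpose_smul, Matrix.smul_mul, map_smul])
    (fun A B B' => by rw [← Matrix.of_add_of, mul_add, map_add])
    (fun c A B => by rw [← Matrix.smul_of, Matrix.mul_smul, map_smul])

/-- The tautological one-form of `T^*SO(3)`. In the left-trivialisation
`T^*SO(3) = SO(3) × so(3)^*` it is `θ(g, m)(T, r) = ⟨m, g⁻¹ T⟩` for `T ∈ T_g SO(3)`. Since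
`g⁻¹ = gᵀ` and `gᵀ T` is skew-symmetric, the formula below extends it to `M₃(ℝ) × ℝ³`. -/
def tautForm (q : MatSpace × E3) : MatSpace × E3 →L[ℝ] ℝ :=
  LinearMap.toContinuousLinearMap
    { toFun := fun u => inner ℝ q.2 (leftVee q.1 u.1)
      map_add' := fun u v => by simp [inner_add_right]
      map_smul' := fun c u => by simp [inner_smul_right] }

/-- The canonical symplectic form `Ω_c = -dθ` of `T^*SO(3) = SO(3) × so(3)^*`, evaluated on
left-trivialised tangent vectors. -/
def canonicalForm (p : SO3 × E3) (v w : E3 × E3) : ℝ :=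
  -dOneForm tautForm (emb p) (embTangent p v) (embTangent p w)

theorem tautForm_apply (q u : MatSpace × E3) :
    tautForm q u = inner ℝ q.2 (leftVee q.1 u.1) := rfl

theorem differentiable_tautForm : Differentiable ℝ tautForm := by
  have h : ContDiff ℝ 1 tautForm := by
    rw [contDiff_clm_apply_iff]
    intro u
    let A : MatSpace × E3 →ₗ[ℝ] E3 :=
      { toFun := fun q => leftVee q.1 u.1
        map_add' := fun x y => by simp
        map_smul' := fun c x => by simp }
    have hA : ContDiff ℝ 1 (LinearMap.toContinuousLinearMap A) :=
      (LinearMap.toContinuousLinearMap A).contDiff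
    exact contDiff_snd.inner ℝ hA
  exact h.differentiable one_ne_zero

theorem fderiv_tautForm (q a u : MatSpace × E3) :
    fderiv ℝ (fun x => tautForm x u) q a =
      inner ℝ a.2 (leftVee q.1 u.1) + inner ℝ q.2 (leftVee a.1 u.1) := by
  have hd : DifferentiableAt ℝ (fun x => tautForm x u) q :=
    (differentiable_tautForm q).clm_apply (differentiableAt_const u)
  have h1 : HasDerivAt (fun t : ℝ => tautForm (q + t • a) u)
      (fderiv ℝ (fun x => tautForm x u) q a) 0 := by
    have h3 : HasDerivAt (fun t : ℝ => q + t • a) a 0 := by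
      have h := ((hasDerivAt_id (0 : ℝ)).smul_const a).const_add q
      rwa [one_smul] at h
    have h4 : HasFDerivAt (fun x => tautForm x u) (fderiv ℝ (fun x => tautForm x u) q)
        (q + (0 : ℝ) • a) := by
      rw [zero_smul, add_zero]; exact hd.hasFDerivAt
    exact h4.comp_hasDerivAt (0 : ℝ) h3
  have h5 : ∀ t : ℝ, tautForm (q + t • a) u =
      inner ℝ q.2 (leftVee q.1 u.1) +
      t * (inner ℝ a.2 (leftVee q.1 u.1) + inner ℝ q.2 (leftVee a.1 u.1)) +
      t ^ 2 * inner ℝ a.2 (leftVee a.1 u.1) := by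
    intro t
    rw [tautForm_apply]
    simp [inner_add_left, inner_add_right, inner_smul_left, inner_smul_right]
    ring
  have h6 : HasDerivAt (fun t : ℝ => tautForm (q + t • a) u)
      (inner ℝ a.2 (leftVee q.1 u.1) + inner ℝ q.2 (leftVee a.1 u.1)) 0 := by
    simp only [h5]
    have h7 := (((hasDerivAt_id (0 : ℝ)).mul_const
      (inner ℝ a.2 (leftVee q.1 u.1) + inner ℝ q.2 (leftVee a.1 u.1))).const_add
      (inner ℝ q.2 (leftVee q.1 u.1))).add
      (((hasDerivAt_id (0 : ℝ)).pow 2).mul_const (inner ℝ a.2 (leftVee a.1 u.1)))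
    refine h7.congr_deriv ?_
    simp
  exact h1.unique h6

/-- The canonical form in left-trivialisation. -/
theorem canonicalForm_eq (p : SO3 × E3) (v w : E3 × E3) :
    canonicalForm p v w =
      inner ℝ p.2 (bracket v.1 w.1) + inner ℝ w.2 v.1 - inner ℝ v.2 w.1 := by
  have hg : (p.1 : M3)ᵀ * (p.1 : M3) = 1 := by
    have h := (Matrix.mem_specialOrthogonalGroup_iff.1 p.1.2).1
    exact (Matrix.mem_orthogonalGroup_iff' (Fin 3) ℝ).1 h
  have h1 : ∀ x : E3, leftVee (emb p).1 (embTangent p (x, (0 : E3))).1 = x := by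
    intro x
    change vee ((p.1 : M3)ᵀ * ((p.1 : M3) * hat x)) = x
    rw [← Matrix.mul_assoc, hg, Matrix.one_mul, vee_hat]
  have h2 : ∀ x y : E3, leftVee (embTangent p (x, (0 : E3))).1 (embTangent p (y, (0 : E3))).1 =
      -vee (hat x * hat y) := by
    intro x y
    change vee (((p.1 : M3) * hat x)ᵀ * ((p.1 : M3) * hat y)) = _
    rw [Matrix.transpose_mul, Matrix.mul_assoc, ← Matrix.mul_assoc _ (p.1 : M3), hg,
      Matrix.one_mul, hat_transpose, Matrix.neg_mul, map_neg]
  rw [canonicalForm, dOneForm_eq _ _ _ _ (differentiable_tautForm _),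
    fderiv_tautForm, fderiv_tautForm]
  change -((inner ℝ v.2 (leftVee (emb p).1 (embTangent p (w.1, (0 : E3))).1)
      + inner ℝ p.2 (leftVee (embTangent p (v.1, (0 : E3))).1 (embTangent p (w.1, (0 : E3))).1))
    - (inner ℝ w.2 (leftVee (emb p).1 (embTangent p (v.1, (0 : E3))).1)
      + inner ℝ p.2 (leftVee (embTangent p (w.1, (0 : E3))).1 (embTangent p (v.1, (0 : E3))).1))) = _
  simp only [h1, h2, bracket, map_sub, inner_sub_right, inner_neg_right]
  ring

/-! ### The model space and the tube -/

section Model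

variable (μ : E3)

/-- The vector space `so(3)_μ^* × T_μ O_μ`. -/
abbrev Slice : Type := isotropy μ × orbitTangent μ

/-- The coordinate of `ν ∈ so(3)_μ^*` under `so(3)_μ^* ≅ ℝ`, `s ↔ s μ / ‖μ‖`. -/
def signedNorm (ν : isotropy μ) : ℝ := inner ℝ (ν : E3) (‖μ‖⁻¹ • μ)

/-- The set `U` of all `(ν, ad*_η μ)`, `η ∈ so(3)_μ^⊥`, with `ν > -‖μ‖` and
`‖η‖ < 2 √(‖μ + ν‖ / ‖μ‖)`. -/
def sliceDomain : Set (Slice μ) :=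
  {s | -‖μ‖ < signedNorm μ s.1 ∧ ∃ η ∈ isotropyPerp μ, adStar η μ = s.2 ∧
    ‖η‖ < 2 * √(‖μ + s.1‖ / ‖μ‖)}

/-- The domain `SO(3) × U`. -/
def tubeDomain : Set (SO3 × Slice μ) := {p | p.2 ∈ sliceDomain μ}

/-- `F(ν, η) = exp (2 arcsin (½ ‖η‖ √(‖μ‖ / ‖μ + ν‖)) η / ‖η‖)`, with `F(ν, 0) = 1`. -/
def tubeRotation (ν η : E3) : SO3 :=
  expSO3 ((2 * Real.arcsin (1 / 2 * ‖η‖ * √(‖μ‖ / ‖μ + ν‖))) • (‖η‖⁻¹ • η))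

/-- `Φ(g, ν, ad*_η μ) = (g F(ν, η)⁻¹, Ad*_{F(ν, η)⁻¹} (μ + ν))`. -/
def tube (p : SO3 × Slice μ) : SO3 × E3 :=
  (p.1 * (tubeRotation μ p.2.1 (orbitInv μ p.2.2))⁻¹,
    AdStar (tubeRotation μ p.2.1 (orbitInv μ p.2.2))⁻¹ (μ + p.2.1))

/-- The form `Ω_Y = Ω_T + Ω_0 + Ω_N` at `(g, ν, ρ)`, on left-trivialised tangent vectors
`(ξ, ν', ad*_ζ μ)`. -/
def modelForm (p : SO3 × Slice μ) (v w : E3 × Slice μ) : ℝ :=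
  inner ℝ μ (bracket v.1 w.1) +
  (inner ℝ (p.2.1 : E3) (bracket v.1 w.1)
    + inner ℝ (w.2.1 : E3) ((isotropy μ).starProjection v.1)
    - inner ℝ (v.2.1 : E3) ((isotropy μ).starProjection w.1)) +
  -inner ℝ μ (bracket (orbitInv μ v.2.2) (orbitInv μ w.2.2))

/-- The map `J_Y(g, ν, ρ) = Ad*_{g⁻¹} (μ + ν)`. -/
def modelMomentum (p : SO3 × Slice μ) : E3 := AdStar p.1⁻¹ (μ + p.2.1)

end Model

end SO3

end

open SO3

noncomputable section

namespace SO3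


/-! ### Algebra of `so(3)` -/

/-! Rodrigues' formula turns `F(ν, η)` into the rotation `R` of the unit quaternion `(q, a)` with `a
= ½ √(‖μ‖/‖μ+ν‖) η` and `q = √(1 - ‖a‖²)` (`coe_tubeRotation`). In these terms `U` says `ν > -‖μ‖`
and `‖a‖ < 1`, that is, rotation angle below `π`; so `q > 0`, and `arcsin` and the division by `‖η‖`
disappear. Smoothness of `Φ`, also at `η = 0`, follows.

Inverse: put `m = Ad_R (μ + ν)`. Then `‖m‖ = ‖μ‖ + ν` determines `ν`, and `R` is the rotation of
angle below `π`, about an axis orthogonal to `μ`, that turns `μ` into the direction of `m`. It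
exists and is unique unless `m` lies on the closed ray through `-μ`, so the image is open, with an
explicit smooth inverse `tubeInv`.

Pullback: let `M = μ + ν` and let `β` be the left-trivialised velocity of `R`. By `Ad`-invariance
(`canonicalForm_rotated`), `Φ^* Ω_c` is the `(ξ, ν)` part of `Ω_Y` plus `-⟨M, [β₁, β₂]⟩ - ⟨ν₂', β₁⟩
+ ⟨ν₁', β₂⟩`, which is `d⟨M, β⟩` by the Maurer-Cartan equation. Since `η ⟂ μ`, `⟨M, β⟩ = -2
(‖M‖/‖μ‖) ⟨μ, [a, a']⟩ = -½ ⟨μ, [η, η']⟩`; the factor in `a` is chosen so that `ν` drops out. Its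
differential is `-⟨μ, [ζ₁, ζ₂]⟩`, as required. Geometrically, `a`, of length `sin(θ/2)`, is
Lambert's equal-area chart of the sphere. The proof checks the identity pointwise, without
differentiating forms (`inner_quatVelocity`, `inner_bracket_quatVelocity`, `pullback_identity`). -/

theorem inner_eq (x y : E3) : inner ℝ x y = x 0 * y 0 + x 1 * y 1 + x 2 * y 2 := by
  simp [PiLp.inner_apply, Fin.sum_univ_three]; ring

theorem hat_injective : Function.Injective hat := fun x y h => by
  rw [← vee_hat x, h, vee_hat]

theorem hat_bracket (x y : E3) : hat (bracket x y) = hat x * hat y - hat y * hat x := by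
  refine hat_vee _ ?_
  rw [Matrix.transpose_sub, Matrix.transpose_mul, Matrix.transpose_mul, hat_transpose,
    hat_transpose]
  simp

theorem inner_eq_trace (x y : E3) : inner ℝ x y = -(1 / 2) * (hat x * hat y).trace := by
  rw [inner_eq, Matrix.trace_fin_three]
  simp [hat, Matrix.mul_apply, Fin.sum_univ_three]
  ring

theorem bracket_add_left (x y z : E3) : bracket (x + y) z = bracket x z + bracket y z := by
  apply hat_injective; simp only [hat_bracket, map_add]; noncomm_ring

theorem bracket_add_right (x y z : E3) : bracket x (y + z) = bracket x y + bracket x z := by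
  apply hat_injective; simp only [hat_bracket, map_add]; noncomm_ring

theorem bracket_smul_left (c : ℝ) (x y : E3) : bracket (c • x) y = c • bracket x y := by
  apply hat_injective; simp [hat_bracket, smul_sub]

theorem bracket_smul_right (c : ℝ) (x y : E3) : bracket x (c • y) = c • bracket x y := by
  apply hat_injective; simp [hat_bracket, smul_sub]

theorem bracket_self (x : E3) : bracket x x = 0 := by
  apply hat_injective; simp [hat_bracket]

theorem bracket_swap (x y : E3) : bracket x y = -bracket y x := by
  apply hat_injective; simp [hat_bracket]

/-- The bracket as a continuous bilinear map. -/
def bracketL : E3 →L[ℝ] E3 →L[ℝ] E3 :=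
  LinearMap.toContinuousBilinearMap
    (LinearMap.mk₂ ℝ bracket bracket_add_left bracket_smul_left bracket_add_right
      bracket_smul_right)

/-- The vector triple product. -/
theorem bracket_bracket (x y z : E3) :
    bracket x (bracket y z) = (inner ℝ x z : ℝ) • y - (inner ℝ x y : ℝ) • z := by
  simp only [inner_eq, bracket_eq]
  ext i; fin_cases i <;> simp <;> ring

theorem inner_bracket_cycle (x y z : E3) :
    inner ℝ x (bracket y z) = inner ℝ y (bracket z x) := by
  simp only [inner_eq, bracket_eq]; simp; ring

theorem inner_self_bracket (x y : E3) : inner ℝ x (bracket x y) = 0 := by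
  simp only [inner_eq, bracket_eq]; simp; ring

/-! ### The adjoint action -/

theorem coe_inv (g : SO3) : ((g⁻¹ : SO3) : M3) = (g : M3)ᵀ := rfl

theorem transpose_mul_self (g : SO3) : (g : M3)ᵀ * (g : M3) = 1 := by
  rw [← coe_inv, ← Submonoid.coe_mul, inv_mul_cancel, Submonoid.coe_one]

theorem hat_Ad' (g : SO3) (ξ : E3) : hat (Ad g ξ) = (g : M3) * hat ξ * (g : M3)ᵀ := hat_Ad g ξ

theorem Ad_apply (g : SO3) (ξ : E3) : Ad g ξ = vee ((g : M3) * hat ξ * (g : M3)ᵀ) := rfl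

theorem Ad_mul (g h : SO3) (ξ : E3) : Ad (g * h) ξ = Ad g (Ad h ξ) := by
  apply hat_injective
  simp only [hat_Ad', Submonoid.coe_mul, Matrix.transpose_mul, mul_assoc]

theorem Ad_one (ξ : E3) : Ad 1 ξ = ξ := by
  apply hat_injective
  simp [hat_Ad']

theorem Ad_Ad_inv (g : SO3) (ξ : E3) : Ad g (Ad g⁻¹ ξ) = ξ := by
  rw [← Ad_mul, mul_inv_cancel, Ad_one]

theorem Ad_bracket (g : SO3) (x y : E3) : Ad g (bracket x y) = bracket (Ad g x) (Ad g y) := by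
  have h : ∀ a b : E3, (g : M3) * hat a * (g : M3)ᵀ * ((g : M3) * hat b * (g : M3)ᵀ) =
      (g : M3) * (hat a * hat b) * (g : M3)ᵀ := fun a b => by
    calc _ = (g : M3) * hat a * ((g : M3)ᵀ * (g : M3)) * (hat b * (g : M3)ᵀ) := by
          simp only [mul_assoc]
      _ = _ := by rw [transpose_mul_self]; simp only [mul_assoc, mul_one]
  apply hat_injective
  rw [hat_bracket, hat_Ad', hat_Ad', hat_Ad', h, h, hat_bracket, mul_sub, sub_mul]

/-- The inner product is a multiple of the trace form, which conjugation preserves. -/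
theorem inner_Ad_Ad (g : SO3) (x y : E3) : inner ℝ (Ad g x) (Ad g y) = inner ℝ x y := by
  rw [inner_eq_trace, inner_eq_trace, hat_Ad', hat_Ad']
  congr 1
  calc _ = ((g : M3) * hat x * ((g : M3)ᵀ * (g : M3)) * hat y * (g : M3)ᵀ).trace := by
        simp only [mul_assoc]
    _ = ((g : M3)ᵀ * ((g : M3) * (hat x * hat y))).trace := by
        rw [transpose_mul_self, mul_one, Matrix.trace_mul_comm]; simp only [mul_assoc]
    _ = _ := by rw [← mul_assoc, transpose_mul_self, one_mul]

theorem inner_Ad_left (g : SO3) (x y : E3) : inner ℝ (Ad g x) y = inner ℝ x (Ad g⁻¹ y) := by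
  rw [← inner_Ad_Ad g x, Ad_Ad_inv]

theorem norm_Ad (g : SO3) (x : E3) : ‖Ad g x‖ = ‖x‖ := by
  rw [norm_eq_sqrt_real_inner, inner_Ad_Ad, ← norm_eq_sqrt_real_inner]

/-- `Ad` acts by isometries, so the inner product identifies the coadjoint action with the adjoint
one. -/
theorem AdStar_inv (g : SO3) (x : E3) : AdStar g⁻¹ x = Ad g x := by
  refine ext_inner_right ℝ fun ζ => ?_
  rw [AdStar, LinearMap.adjoint_inner_left, inner_Ad_left]

/-! ### Rotations -/

/-- The matrix of the rotation given by the unit quaternion with scalar part `q` and vector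
part `a`. -/
def quatMat (q : ℝ) (a : E3) : M3 := 1 + (2 * q) • hat a + (2 : ℝ) • (hat a * hat a)

/-- Both this and the next lemma are polynomial identities modulo the unit-norm relation; `key`
displays the multiple of that relation which has to be discarded. -/
theorem quatMat_conj (q : ℝ) (a v : E3) (h : q ^ 2 + ‖a‖ ^ 2 = 1) :
    vee (quatMat q a * hat v * (quatMat q a)ᵀ) =
      v + (2 * q) • bracket a v + (2 : ℝ) • bracket a (bracket a v) := by
  have key : quatMat q a * hat v * (quatMat q a)ᵀ =
      hat (v + (2 * q) • bracket a v + (2 : ℝ) • bracket a (bracket a v)) +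
        (q ^ 2 + ‖a‖ ^ 2 - 1) • ((4 * inner ℝ a v) • hat a) := by
    simp only [bracket_eq, quatMat, normSq_eq, inner_eq]
    ext i j
    fin_cases i <;> fin_cases j <;>
      simp [hat, Matrix.mul_apply, Fin.sum_univ_three, Matrix.one_apply] <;> ring
  rw [key, h, sub_self, zero_smul, add_zero, vee_hat]

/-- The right-hand side is the derivative of `quatMat` along `(q', a')`, so the argument of `hat` on
the left is the left-trivialised velocity. The hypothesis `h'` is the derivative of the unit-norm
relation `h`. -/
theorem quatMat_mul_hat (q q' : ℝ) (a a' : E3) (h : q ^ 2 + ‖a‖ ^ 2 = 1)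
    (h' : q * q' + inner ℝ a a' = 0) :
    quatMat q a * hat ((2 : ℝ) • (q • a' - q' • a - bracket a a')) =
      (2 * q') • hat a + (2 * q) • hat a' + (2 : ℝ) • (hat a' * hat a + hat a * hat a') := by
  have key : quatMat q a * hat ((2 : ℝ) • (q • a' - q' • a - bracket a a')) =
      (2 * q') • hat a + (2 * q) • hat a' + (2 : ℝ) • (hat a' * hat a + hat a * hat a') +
        (q ^ 2 + ‖a‖ ^ 2 - 1) • ((4 * q') • hat a + (4 : ℝ) • (hat a * hat a')) -
        (q * q' + inner ℝ a a') • ((4 * q) • hat a + (4 : ℝ) • (hat a * hat a)) := by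
    simp only [bracket_eq, quatMat, normSq_eq, inner_eq]
    ext i j
    fin_cases i <;> fin_cases j <;>
      simp [hat, Matrix.mul_apply, Fin.sum_univ_three, Matrix.one_apply] <;> ring
  rw [key, h, h', sub_self, zero_smul, zero_smul, add_zero, sub_zero]

/-- Cayley-Hamilton: the characteristic polynomial of `hat u` is `X³ + ‖u‖² X`. -/
theorem hat_cube (u : E3) : hat u * hat u * hat u = -(‖u‖ ^ 2 • hat u) := by
  rw [normSq_eq]
  ext i j
  fin_cases i <;> fin_cases j <;>
    simp [hat, Matrix.mul_apply, Fin.sum_univ_three] <;> ring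

section Rodrigues

attribute [local instance] Matrix.linftyOpNormedRing Matrix.linftyOpNormedAlgebra

/-- Rodrigues' rotation formula. -/
theorem exp_hat_smul (u : E3) (hu : ‖u‖ = 1) (t : ℝ) :
    NormedSpace.exp (hat (t • u)) =
      1 + Real.sin t • hat u + (1 - Real.cos t) • (hat u * hat u) := by
  have hc := hat_cube u
  rw [hu, one_pow, one_smul] at hc
  set A := hat u with hA
  -- Rodrigues' expression multiplied by `exp(-tA)`; its derivative vanishes because `A³ = -A`.
  let f : ℝ → M3 := fun t => NormedSpace.exp (t • (-A)) *
    (1 + Real.sin t • A + (1 - Real.cos t) • (A * A))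
  have hf : ∀ t, HasDerivAt f 0 t := fun t => by
    have h1 := hasDerivAt_exp_smul_const (𝕂 := ℝ) (-A) t
    have h2 := ((Real.hasDerivAt_sin t).smul_const A).const_add 1 |>.add
      (((Real.hasDerivAt_cos t).const_sub 1).smul_const (A * A))
    refine (h1.mul h2).congr_deriv ?_
    have h3 : -A * (1 + Real.sin t • A + (1 - Real.cos t) • (A * A)) +
        (Real.cos t • A + - -Real.sin t • (A * A)) = 0 := by
      simp only [mul_add, neg_mul, mul_smul_comm, ← mul_assoc, hc, mul_one]
      module
    rw [mul_assoc]
    exact (mul_add _ _ _).symm.trans ((congrArg _ h3).trans (mul_zero _))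
  have hconst : f t = f 0 :=
    is_const_of_deriv_eq_zero (fun x => (hf x).differentiableAt) (fun x => (hf x).deriv) t 0
  have h0 : f 0 = 1 := by simp [f, NormedSpace.exp_zero]
  have hmul : NormedSpace.exp (t • A) * NormedSpace.exp (t • (-A)) = 1 := by
    rw [← Matrix.exp_add_of_commute _ _ (show Commute (t • A) (t • (-A)) by
      simp [Commute, SemiconjBy])]
    simp
  rw [map_smul, ← hA]
  calc NormedSpace.exp (t • A) = NormedSpace.exp (t • A) * f t := by rw [hconst, h0, mul_one]
    _ = _ := by simp only [f]; rw [← mul_assoc, hmul, one_mul]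

end Rodrigues

/-- Half-angle formulas: for `x = arcsin ‖a‖`, `sin 2x = 2 q ‖a‖` and `1 - cos 2x = 2 ‖a‖²`. At `a =
0` the convention `0⁻¹ = 0` makes both sides the identity. -/
theorem coe_expSO3_arcsin (a : E3) (ha : ‖a‖ ≤ 1) :
    (expSO3 ((2 * Real.arcsin ‖a‖) • (‖a‖⁻¹ • a)) : M3) = quatMat (√(1 - ‖a‖ ^ 2)) a := by
  change NormedSpace.exp _ = _
  rcases eq_or_ne a 0 with rfl | h0
  · simp [quatMat, NormedSpace.exp_zero]
  have hn : ‖a‖ ≠ 0 := norm_ne_zero_iff.2 h0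
  rw [exp_hat_smul _ (by rw [norm_smul, norm_inv, norm_norm, inv_mul_cancel₀ hn]),
    Real.sin_two_mul, Real.cos_two_mul', Real.sin_arcsin (by linarith [norm_nonneg a]) ha,
    Real.cos_arcsin, Real.sq_sqrt (by nlinarith [norm_nonneg a]), quatMat]
  simp only [map_smul, Matrix.smul_mul, Matrix.mul_smul, smul_smul]
  congr 2
  · congr 1; field_simp
  · field_simp; ring


/-! ### The isotropy algebra and the orbit directions -/

section Slice

variable {μ : E3}

theorem mem_isotropy_iff {ν : E3} : ν ∈ isotropy μ ↔ bracket μ ν = 0 := by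
  rw [← adStar_eq]; rfl

theorem isotropy_coe_eq (hμ : μ ≠ 0) (ν : isotropy μ) :
    (ν : E3) = (signedNorm μ ν / ‖μ‖) • μ := by
  -- From `μ × ν = 0` the triple product `μ × (μ × ν) = ⟨μ, ν⟩ μ - ‖μ‖² ν` vanishes, which solves
  -- for `ν`.
  have hr : ‖μ‖ ≠ 0 := norm_ne_zero_iff.2 hμ
  have h := bracket_bracket μ μ (ν : E3)
  have h0 : bracket μ (0 : E3) = 0 := (ad μ).map_zero
  rw [mem_isotropy_iff.1 ν.2, real_inner_self_eq_norm_sq, h0, eq_comm, sub_eq_zero, eq_comm,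
    ← eq_inv_smul_iff₀ (pow_ne_zero 2 hr), smul_smul] at h
  rw [signedNorm, inner_smul_right, real_inner_comm]
  refine h.trans ?_
  congr 1
  field_simp

theorem inner_isotropy (hμ : μ ≠ 0) (ν : isotropy μ) (x : E3) :
    inner ℝ (ν : E3) x = signedNorm μ ν / ‖μ‖ * inner ℝ μ x := by
  rw [isotropy_coe_eq hμ ν, real_inner_smul_left]

theorem add_isotropy_eq (hμ : μ ≠ 0) (ν : isotropy μ) :
    μ + (ν : E3) = ((‖μ‖ + signedNorm μ ν) / ‖μ‖) • μ := by
  have hr : ‖μ‖ ≠ 0 := norm_ne_zero_iff.2 hμ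
  rw [add_div, div_self hr, add_smul, one_smul, ← isotropy_coe_eq hμ ν]

/-- The bound on `ν` makes `μ + ν` a positive multiple of `μ`, so its norm is affine in `ν`. -/
theorem norm_add_isotropy (hμ : μ ≠ 0) (ν : isotropy μ) (hν : -‖μ‖ < signedNorm μ ν) :
    ‖μ + (ν : E3)‖ = ‖μ‖ + signedNorm μ ν := by
  have hr : 0 < ‖μ‖ := norm_pos_iff.2 hμ
  rw [add_isotropy_eq hμ, norm_smul, Real.norm_of_nonneg (by apply div_nonneg <;> linarith)]
  field_simp

theorem mem_isotropyPerp_iff (hμ : μ ≠ 0) {η : E3} :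
    η ∈ isotropyPerp μ ↔ inner ℝ μ η = 0 := by
  refine ⟨fun h => (Submodule.mem_orthogonal _ _).1 h μ (self_mem_isotropy μ), fun h => ?_⟩
  refine (Submodule.mem_orthogonal _ _).2 fun u hu => ?_
  rw [inner_isotropy hμ ⟨u, hu⟩, h, mul_zero]

theorem inner_orbitInv (hμ : μ ≠ 0) (ρ : orbitTangent μ) : inner ℝ μ (orbitInv μ ρ) = 0 :=
  (mem_isotropyPerp_iff hμ).1 (orbitInv_spec μ hμ ρ).1

/-- `orbitInv` as a linear map. -/
def orbitInvL (μ : E3) : orbitTangent μ →L[ℝ] E3 :=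
  LinearMap.toContinuousLinearMap
    { toFun := orbitInv μ
      map_add' := fun x y => by simp [orbitInv, bracket_add_left]
      map_smul' := fun c x => by simp [orbitInv, bracket_smul_left, smul_comm c] }

/-- `signedNorm` as a linear map. -/
def signedNormL (μ : E3) : isotropy μ →L[ℝ] ℝ :=
  ((innerSL ℝ).flip (‖μ‖⁻¹ • μ)).comp (isotropy μ).subtypeL

/-- The vector part of the unit quaternion of the rotation `F(ν, η)`. -/
def sliceQuat (μ : E3) (s : Slice μ) : E3 :=
  (1 / 2 * √(‖μ‖ / ‖μ + s.1‖)) • orbitInv μ s.2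

theorem inner_sliceQuat (hμ : μ ≠ 0) (s : Slice μ) : inner ℝ μ (sliceQuat μ s) = 0 := by
  rw [sliceQuat, inner_smul_right, inner_orbitInv hμ, mul_zero]

theorem norm_add_pos (hμ : μ ≠ 0) {ν : isotropy μ} (h : -‖μ‖ < signedNorm μ ν) :
    0 < ‖μ + (ν : E3)‖ := by
  rw [norm_add_isotropy hμ ν h]; linarith

theorem norm_sliceQuat (s : Slice μ) :
    ‖sliceQuat μ s‖ = 1 / 2 * ‖orbitInv μ s.2‖ * √(‖μ‖ / ‖μ + s.1‖) := by
  rw [sliceQuat, norm_smul, Real.norm_of_nonneg (by positivity)]; ring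

theorem mem_sliceDomain_iff_orbitInv (hμ : μ ≠ 0) (s : Slice μ) :
    s ∈ sliceDomain μ ↔
      -‖μ‖ < signedNorm μ s.1 ∧ ‖orbitInv μ s.2‖ < 2 * √(‖μ + s.1‖ / ‖μ‖) := by
  refine and_congr_right fun hs => ⟨?_, fun h =>
    ⟨_, (orbitInv_spec μ hμ s.2).1, (orbitInv_spec μ hμ s.2).2, h⟩⟩
  rintro ⟨η, hη, h2, h3⟩
  have h4 : orbitInv μ s.2 = η := by
    rw [← orbitInv_adStar μ hμ η hη]; congr 1; exact Subtype.ext h2.symm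
  rwa [h4]

theorem mem_sliceDomain_iff (hμ : μ ≠ 0) (s : Slice μ) :
    s ∈ sliceDomain μ ↔ -‖μ‖ < signedNorm μ s.1 ∧ ‖sliceQuat μ s‖ < 1 := by
  rw [mem_sliceDomain_iff_orbitInv hμ]
  refine and_congr_right fun hs => ?_
  have hk := norm_add_pos hμ hs
  have hr : 0 < ‖μ‖ := norm_pos_iff.2 hμ
  have hx : 0 < √(‖μ + s.1‖ / ‖μ‖) := Real.sqrt_pos.2 (by positivity)
  rw [norm_sliceQuat, ← inv_div ‖μ + s.1‖ ‖μ‖, Real.sqrt_inv, ← div_eq_mul_inv, div_lt_one hx]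
  constructor <;> intro h <;> linarith

theorem coe_tubeRotation (hμ : μ ≠ 0) {s : Slice μ} (hs : s ∈ sliceDomain μ) :
    (tubeRotation μ s.1 (orbitInv μ s.2) : M3) =
      quatMat (√(1 - ‖sliceQuat μ s‖ ^ 2)) (sliceQuat μ s) := by
  obtain ⟨h1, h2⟩ := (mem_sliceDomain_iff hμ s).1 hs
  have hk := norm_add_pos hμ h1
  have hr : 0 < ‖μ‖ := norm_pos_iff.2 hμ
  rw [← coe_expSO3_arcsin _ h2.le, tubeRotation, norm_sliceQuat, sliceQuat]
  congr 3
  have hc : 0 < 1 / 2 * √(‖μ‖ / ‖μ + s.1‖) := by positivity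
  rw [smul_smul]
  congr 1
  rcases eq_or_ne ‖orbitInv μ s.2‖ 0 with h | h
  · simp [h]
  · field_simp

theorem sqrt_sq_add_sq {a : E3} (ha : ‖a‖ < 1) : √(1 - ‖a‖ ^ 2) ^ 2 + ‖a‖ ^ 2 = 1 := by
  rw [Real.sq_sqrt (by nlinarith [norm_nonneg a])]; ring

theorem sqrt_pos_of_norm_lt {a : E3} (ha : ‖a‖ < 1) : 0 < √(1 - ‖a‖ ^ 2) :=
  Real.sqrt_pos.2 (by nlinarith [norm_nonneg a])

/-- Orthogonality of `a` and `μ` reduces `a × (a × μ)` to `-‖a‖² μ`. -/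
theorem Ad_eq_of_coe_eq {R : SO3} {a : E3} (ha : ‖a‖ < 1)
    (hR : (R : M3) = quatMat (√(1 - ‖a‖ ^ 2)) a) (haμ : inner ℝ μ a = 0) :
    Ad R μ = (1 - 2 * ‖a‖ ^ 2) • μ + (2 * √(1 - ‖a‖ ^ 2)) • bracket a μ := by
  rw [Ad_apply, hR, quatMat_conj _ _ _ (sqrt_sq_add_sq ha), bracket_bracket, real_inner_comm, haμ,
    real_inner_self_eq_norm_sq]
  module

theorem isOpen_sliceDomain (hμ : μ ≠ 0) : IsOpen (sliceDomain μ) := by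
  have h : sliceDomain μ = {s | -‖μ‖ < signedNormL μ s.1 ∧
      ‖orbitInvL μ s.2‖ < 2 * √(‖μ + s.1‖ / ‖μ‖)} := by
    ext s
    exact mem_sliceDomain_iff_orbitInv hμ s
  rw [h]
  refine IsOpen.and (isOpen_lt continuous_const (by fun_prop)) (isOpen_lt (by fun_prop) ?_)
  refine continuous_const.mul (Continuous.sqrt (Continuous.div_const ?_ _))
  exact (continuous_const.add (continuous_subtype_val.comp continuous_fst)).norm

theorem isOpen_tubeDomain (hμ : μ ≠ 0) : IsOpen (tubeDomain μ) :=
  (isOpen_sliceDomain hμ).preimage continuous_snd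

theorem zero_mem_sliceDomain (hμ : μ ≠ 0) : (0 : Slice μ) ∈ sliceDomain μ := by
  have hr : 0 < ‖μ‖ := norm_pos_iff.2 hμ
  rw [mem_sliceDomain_iff hμ, norm_sliceQuat]
  simp [signedNorm, orbitInv, hr, hμ, bracket]

theorem tube_eq (p : SO3 × Slice μ) :
    tube μ p = (p.1 * (tubeRotation μ p.2.1 (orbitInv μ p.2.2))⁻¹,
      Ad (tubeRotation μ p.2.1 (orbitInv μ p.2.2)) (μ + p.2.1)) := by
  rw [tube, AdStar_inv]

theorem tube_one_zero : tube μ (1, 0) = (1, μ) := by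
  have h : tubeRotation μ (0 : E3) 0 = 1 := by
    apply Subtype.ext
    change NormedSpace.exp (hat _) = 1
    simp [NormedSpace.exp_zero]
  have h0 : orbitInv μ 0 = 0 := by simp [orbitInv, bracket]
  rw [tube_eq]
  simp [h0, h, Ad_one]

theorem tube_mul (h g : SO3) (s : Slice μ) :
    tube μ (h * g, s) = (h * (tube μ (g, s)).1, (tube μ (g, s)).2) := by
  simp only [tube, mul_assoc]

theorem tube_adStar (hμ : μ ≠ 0) (g : SO3) (ν : isotropy μ) (η : E3) (hη : η ∈ isotropyPerp μ) :
    tube μ (g, ν, ⟨adStar η μ, η, rfl⟩) =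
      (g * (tubeRotation μ ν η)⁻¹, AdStar (tubeRotation μ ν η)⁻¹ (μ + ν)) := by
  simp only [tube, orbitInv_adStar μ hμ η hη]

end Slice


/-! ### The inverse of the tube -/

section Inverse

variable {μ : E3}

/-- The image of the tube, in the variable `m`. -/
def momentumDomain (μ : E3) : Set E3 := {m | 0 < ‖μ‖ * ‖m‖ + inner ℝ μ m}

/-- The vector part of the unit quaternion that rotates `μ` into the direction of `m`. -/
def momentumQuat (μ m : E3) : E3 :=
  (√(2 * (‖μ‖ * ‖m‖) * (‖μ‖ * ‖m‖ + inner ℝ μ m)))⁻¹ • bracket μ m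

/-- The slice coordinates of the preimage of `(h, m)` under the tube. -/
def momentumSlice (μ m : E3) : Slice μ :=
  (((‖m‖ - ‖μ‖) / ‖μ‖) • ⟨μ, self_mem_isotropy μ⟩,
    ⟨adStar ((2 * √(‖m‖ / ‖μ‖)) • momentumQuat μ m) μ, _, rfl⟩)

/-- The inverse of the tube. -/
def tubeInv (μ : E3) (p : SO3 × E3) : SO3 × Slice μ :=
  (p.1 * tubeRotation μ (momentumSlice μ p.2).1 (orbitInv μ (momentumSlice μ p.2).2),
    momentumSlice μ p.2)

theorem inner_momentumQuat (m : E3) : inner ℝ μ (momentumQuat μ m) = 0 := by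
  rw [momentumQuat, inner_smul_right, inner_self_bracket, mul_zero]

theorem norm_pos_of_mem {m : E3} (hm : m ∈ momentumDomain μ) : 0 < ‖m‖ := by
  refine norm_pos_iff.2 fun h => ?_
  simp [momentumDomain, h] at hm

/-- Lagrange's identity. -/
theorem norm_bracket_sq (x y : E3) : ‖bracket x y‖ ^ 2 = ‖x‖ ^ 2 * ‖y‖ ^ 2 - inner ℝ x y ^ 2 := by
  simp only [normSq_eq, inner_eq, bracket_eq]; simp; ring

/-- With `θ` the angle between `μ` and `m`, the normalising root in `momentumQuat` is `2 ‖μ‖ ‖m‖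
cos(θ/2)`, while `‖μ × m‖ = 2 ‖μ‖ ‖m‖ sin(θ/2) cos(θ/2)`. The value is therefore `sin²(θ/2)`. -/
theorem norm_momentumQuat_sq (hμ : μ ≠ 0) {m : E3} (hm : m ∈ momentumDomain μ) :
    ‖momentumQuat μ m‖ ^ 2 = (‖μ‖ * ‖m‖ - inner ℝ μ m) / (2 * (‖μ‖ * ‖m‖)) := by
  have hr : 0 < ‖μ‖ := norm_pos_iff.2 hμ
  have hk := norm_pos_of_mem hm
  have hd : 0 < ‖μ‖ * ‖m‖ + inner ℝ μ m := hm
  rw [momentumQuat, norm_smul, mul_pow, norm_inv, inv_pow, norm_bracket_sq, Real.norm_eq_abs,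
    sq_abs, Real.sq_sqrt (by positivity)]
  field_simp
  ring

theorem norm_momentumQuat_lt (hμ : μ ≠ 0) {m : E3} (hm : m ∈ momentumDomain μ) :
    ‖momentumQuat μ m‖ < 1 := by
  have hr : 0 < ‖μ‖ := norm_pos_iff.2 hμ
  have hk := norm_pos_of_mem hm
  have hd : 0 < ‖μ‖ * ‖m‖ + inner ℝ μ m := hm
  rw [← sq_lt_one_iff₀ (norm_nonneg _), norm_momentumQuat_sq hμ hm, div_lt_one (by positivity)]
  linarith

theorem signedNorm_momentumSlice (hμ : μ ≠ 0) (m : E3) :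
    signedNorm μ (momentumSlice μ m).1 = ‖m‖ - ‖μ‖ := by
  have hr : ‖μ‖ ≠ 0 := norm_ne_zero_iff.2 hμ
  simp only [signedNorm, momentumSlice, Submodule.coe_smul, real_inner_smul_left, inner_smul_right,
    real_inner_self_eq_norm_sq]
  field_simp

theorem neg_norm_lt_signedNorm_momentumSlice (hμ : μ ≠ 0) {m : E3} (hm : m ∈ momentumDomain μ) :
    -‖μ‖ < signedNorm μ (momentumSlice μ m).1 := by
  rw [signedNorm_momentumSlice hμ]; linarith [norm_pos_of_mem hm]

theorem orbitInv_momentumSlice (hμ : μ ≠ 0) (m : E3) :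
    orbitInv μ (momentumSlice μ m).2 = (2 * √(‖m‖ / ‖μ‖)) • momentumQuat μ m :=
  orbitInv_adStar μ hμ _ ((mem_isotropyPerp_iff hμ).2 (by
    rw [inner_smul_right, inner_momentumQuat, mul_zero]))

theorem add_momentumSlice (hμ : μ ≠ 0) (m : E3) :
    μ + ((momentumSlice μ m).1 : E3) = (‖m‖ / ‖μ‖) • μ := by
  rw [add_isotropy_eq hμ, signedNorm_momentumSlice hμ]; congr 2; ring

theorem sliceQuat_momentumSlice (hμ : μ ≠ 0) {m : E3} (hm : m ∈ momentumDomain μ) :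
    sliceQuat μ (momentumSlice μ m) = momentumQuat μ m := by
  have hr : 0 < ‖μ‖ := norm_pos_iff.2 hμ
  have hk := norm_pos_of_mem hm
  rw [sliceQuat, orbitInv_momentumSlice hμ,
    norm_add_isotropy hμ _ (neg_norm_lt_signedNorm_momentumSlice hμ hm),
    signedNorm_momentumSlice hμ, smul_smul, add_sub_cancel, ← inv_div ‖m‖ ‖μ‖, Real.sqrt_inv]
  have hx : √(‖m‖ / ‖μ‖) ≠ 0 := (Real.sqrt_pos.2 (by positivity)).ne'
  convert one_smul ℝ _
  field_simp

theorem momentumSlice_mem (hμ : μ ≠ 0) {m : E3} (hm : m ∈ momentumDomain μ) :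
    momentumSlice μ m ∈ sliceDomain μ := by
  rw [mem_sliceDomain_iff hμ, sliceQuat_momentumSlice hμ hm]
  exact ⟨neg_norm_lt_signedNorm_momentumSlice hμ hm, norm_momentumQuat_lt hμ hm⟩

theorem Ad_add_momentumSlice (hμ : μ ≠ 0) {m : E3} (hm : m ∈ momentumDomain μ) :
    Ad (tubeRotation μ (momentumSlice μ m).1 (orbitInv μ (momentumSlice μ m).2))
      (μ + (momentumSlice μ m).1) = m := by
  have hr : 0 < ‖μ‖ := norm_pos_iff.2 hμ
  have hk := norm_pos_of_mem hm
  have hd : 0 < ‖μ‖ * ‖m‖ + inner ℝ μ m := hm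
  have ha := norm_momentumQuat_lt hμ hm
  have hR := coe_tubeRotation hμ (momentumSlice_mem hμ hm)
  rw [sliceQuat_momentumSlice hμ hm] at hR
  rw [add_momentumSlice hμ, map_smul, Ad_eq_of_coe_eq ha hR (inner_momentumQuat m),
    norm_momentumQuat_sq hμ hm]
  set d := ‖μ‖ * ‖m‖ + inner ℝ μ m with hd'
  have hp : 0 < ‖μ‖ * ‖m‖ := by positivity
  -- The scalar part `cos(θ/2)`, expressed by the same root that normalises `momentumQuat`; the root
  -- then cancels, leaving coefficient `1` on `m` and `0` on `μ`.
  have h1 : √(1 - (‖μ‖ * ‖m‖ - inner ℝ μ m) / (2 * (‖μ‖ * ‖m‖))) =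
      √(2 * (‖μ‖ * ‖m‖) * d) / (2 * (‖μ‖ * ‖m‖)) := by
    rw [← Real.sqrt_sq (by positivity : 0 ≤ 2 * (‖μ‖ * ‖m‖)), ← Real.sqrt_div (by positivity),
      Real.sqrt_sq (by positivity)]
    congr 1
    rw [hd']
    field_simp
    ring
  have hD : √(2 * (‖μ‖ * ‖m‖) * d) ≠ 0 := (Real.sqrt_pos.2 (by positivity)).ne'
  have h2 : bracket (momentumQuat μ m) μ = (√(2 * (‖μ‖ * ‖m‖) * d))⁻¹ •
      (‖μ‖ ^ 2 • m - inner ℝ μ m • μ) := by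
    rw [momentumQuat, bracket_smul_left, bracket_swap, bracket_bracket, neg_sub,
      real_inner_self_eq_norm_sq]
  rw [h1, h2]
  match_scalars
  · field_simp; ring
  · field_simp

theorem tube_tubeInv (hμ : μ ≠ 0) {p : SO3 × E3} (hp : p.2 ∈ momentumDomain μ) :
    tube μ (tubeInv μ p) = p := by
  rw [tube_eq]
  refine Prod.ext ?_ (Ad_add_momentumSlice hμ hp)
  simp [tubeInv]

theorem Ad_tubeRotation (hμ : μ ≠ 0) {s : Slice μ} (hs : s ∈ sliceDomain μ) :
    Ad (tubeRotation μ s.1 (orbitInv μ s.2)) (μ + s.1) =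
      (‖μ + s.1‖ / ‖μ‖) • ((1 - 2 * ‖sliceQuat μ s‖ ^ 2) • μ +
        (2 * √(1 - ‖sliceQuat μ s‖ ^ 2)) • bracket (sliceQuat μ s) μ) := by
  obtain ⟨h1, h2⟩ := (mem_sliceDomain_iff hμ s).1 hs
  rw [← Ad_eq_of_coe_eq h2 (coe_tubeRotation hμ hs) (inner_sliceQuat hμ s),
    norm_add_isotropy hμ _ h1, ← map_smul, ← add_isotropy_eq hμ]

theorem inner_Ad_tubeRotation (hμ : μ ≠ 0) {s : Slice μ} (hs : s ∈ sliceDomain μ) :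
    inner ℝ μ (Ad (tubeRotation μ s.1 (orbitInv μ s.2)) (μ + s.1)) =
      ‖μ‖ * ‖μ + s.1‖ * (1 - 2 * ‖sliceQuat μ s‖ ^ 2) := by
  have hr : ‖μ‖ ≠ 0 := norm_ne_zero_iff.2 hμ
  rw [Ad_tubeRotation hμ hs, inner_smul_right, inner_add_right, inner_smul_right, inner_smul_right,
    bracket_swap, inner_neg_right, inner_self_bracket, real_inner_self_eq_norm_sq]
  field_simp
  ring

/-- The cosine of the rotation angle is `1 - 2 ‖a‖² > -1`, so the image vector is never antiparallel
to `μ`. -/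
theorem Ad_tubeRotation_mem (hμ : μ ≠ 0) {s : Slice μ} (hs : s ∈ sliceDomain μ) :
    Ad (tubeRotation μ s.1 (orbitInv μ s.2)) (μ + s.1) ∈ momentumDomain μ := by
  obtain ⟨h1, h2⟩ := (mem_sliceDomain_iff hμ s).1 hs
  have hk := norm_add_pos hμ h1
  have hr : 0 < ‖μ‖ := norm_pos_iff.2 hμ
  rw [momentumDomain, Set.mem_ofPred_eq, norm_Ad, inner_Ad_tubeRotation hμ hs]
  have h3 : ‖sliceQuat μ s‖ ^ 2 < 1 := (sq_lt_one_iff₀ (norm_nonneg _)).2 h2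
  have h4 : 0 < ‖μ‖ * ‖μ + s.1‖ * (1 - ‖sliceQuat μ s‖ ^ 2) :=
    mul_pos (by positivity) (by linarith)
  linarith

theorem momentumQuat_Ad_tubeRotation (hμ : μ ≠ 0) {s : Slice μ} (hs : s ∈ sliceDomain μ) :
    momentumQuat μ (Ad (tubeRotation μ s.1 (orbitInv μ s.2)) (μ + s.1)) = sliceQuat μ s := by
  obtain ⟨h1, h2⟩ := (mem_sliceDomain_iff hμ s).1 hs
  have hk := norm_add_pos hμ h1
  have hr : 0 < ‖μ‖ := norm_pos_iff.2 hμ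
  have hq := sqrt_pos_of_norm_lt h2
  have hq2 := sqrt_sq_add_sq h2
  rw [momentumQuat, norm_Ad, inner_Ad_tubeRotation hμ hs, Ad_tubeRotation hμ hs]
  set q := √(1 - ‖sliceQuat μ s‖ ^ 2)
  -- The radicand is a perfect square because `1 - ‖a‖² = q²`; positivity of `q` selects the root.
  have h3 : 2 * (‖μ‖ * ‖μ + s.1‖) *
      (‖μ‖ * ‖μ + s.1‖ + ‖μ‖ * ‖μ + s.1‖ * (1 - 2 * ‖sliceQuat μ s‖ ^ 2)) =
      (2 * ‖μ‖ * ‖μ + s.1‖ * q) ^ 2 := by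
    linear_combination -(4 * ‖μ‖ ^ 2 * ‖μ + s.1‖ ^ 2) * hq2
  rw [h3, Real.sqrt_sq (by positivity), bracket_smul_right, bracket_add_right, bracket_smul_right,
    bracket_smul_right, bracket_self, bracket_bracket, inner_sliceQuat hμ,
    real_inner_self_eq_norm_sq]
  match_scalars
  · field_simp
  · ring

theorem tubeInv_tube (hμ : μ ≠ 0) {p : SO3 × Slice μ} (hp : p ∈ tubeDomain μ) :
    tubeInv μ (tube μ p) = p := by
  have hs : p.2 ∈ sliceDomain μ := hp
  obtain ⟨h1, h2⟩ := (mem_sliceDomain_iff hμ p.2).1 hs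
  have hk := norm_add_pos hμ h1
  have hr : 0 < ‖μ‖ := norm_pos_iff.2 hμ
  -- The norm returns `ν`, the quaternion returns `a`, and undoing the scale factor returns `η`. The
  -- group component then follows by cancelling the rotation.
  have h : momentumSlice μ (tube μ p).2 = p.2 := by
    rw [tube_eq]
    refine Prod.ext (Subtype.ext ?_) (Subtype.ext ?_)
    · simp only [momentumSlice, norm_Ad, Submodule.coe_smul]
      rw [norm_add_isotropy hμ _ h1, add_sub_cancel_left, ← isotropy_coe_eq hμ]
    · rw [← (orbitInv_spec μ hμ p.2.2).2]
      simp only [momentumSlice, norm_Ad, momentumQuat_Ad_tubeRotation hμ hs]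
      congr 2
      rw [sliceQuat, smul_smul, ← inv_div ‖μ + p.2.1‖ ‖μ‖, Real.sqrt_inv]
      have hx : √(‖μ + p.2.1‖ / ‖μ‖) ≠ 0 := (Real.sqrt_pos.2 (by positivity)).ne'
      convert one_smul ℝ _
      field_simp
  refine Prod.ext ?_ h
  rw [tubeInv, h, tube_eq]
  simp

theorem image_tube (hμ : μ ≠ 0) :
    tube μ '' tubeDomain μ = {p : SO3 × E3 | p.2 ∈ momentumDomain μ} := by
  ext p
  constructor
  · rintro ⟨x, hx, rfl⟩
    rw [tube_eq]
    exact Ad_tubeRotation_mem hμ hx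
  · exact fun hp => ⟨tubeInv μ p, momentumSlice_mem hμ hp, tube_tubeInv hμ hp⟩

theorem isOpen_momentumDomain : IsOpen (momentumDomain μ) :=
  isOpen_lt continuous_const (by fun_prop)

theorem isOpen_image_tube (hμ : μ ≠ 0) : IsOpen (tube μ '' tubeDomain μ) := by
  rw [image_tube hμ]
  exact isOpen_momentumDomain.preimage continuous_snd

end Inverse

/-! ### Smoothness -/

/-- Matrix multiplication as a continuous bilinear map. -/
def matMulL : MatSpace →L[ℝ] MatSpace →L[ℝ] MatSpace :=
  LinearMap.toContinuousBilinearMap (LinearMap.mk₂ ℝ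
    (fun A B => Matrix.of.symm (Matrix.of A * Matrix.of B))
    (fun A A' B => add_mul (Matrix.of A) (Matrix.of A') (Matrix.of B))
    (fun c A B => Matrix.smul_mul c (Matrix.of A) (Matrix.of B))
    (fun A B B' => mul_add (Matrix.of A) (Matrix.of B) (Matrix.of B'))
    (fun c A B => Matrix.mul_smul (Matrix.of A) c (Matrix.of B)))

/-- Matrix transposition as a continuous linear map. -/
def transposeL : MatSpace →L[ℝ] MatSpace :=
  LinearMap.toContinuousLinearMap
    { toFun := fun A => Matrix.of.symm (Matrix.of A)ᵀ
      map_add' := fun _ _ => rfl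
      map_smul' := fun _ _ => rfl }

/-- The hat map as a continuous linear map. -/
def hatL : E3 →L[ℝ] MatSpace :=
  LinearMap.toContinuousLinearMap
    { toFun := fun v => Matrix.of.symm (hat v)
      map_add' := fun v w => congrArg Matrix.of.symm (map_add hat v w)
      map_smul' := fun c v => congrArg Matrix.of.symm (map_smul hat c v) }

/-- The inverse of the hat map as a continuous linear map. -/
def veeL : MatSpace →L[ℝ] E3 :=
  LinearMap.toContinuousLinearMap
    { toFun := fun A => vee (Matrix.of A)
      map_add' := fun A B => map_add vee (Matrix.of A) (Matrix.of B)
      map_smul' := fun c A => map_smul vee c (Matrix.of A) }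

section Smooth

variable {E : Type*} [NormedAddCommGroup E] [NormedSpace ℝ E] {S : Set E} {n : WithTop ℕ∞}

theorem contDiffOn_mul {A B : E → M3}
    (hA : ContDiffOn ℝ n (fun x => (Matrix.of.symm (A x) : MatSpace)) S)
    (hB : ContDiffOn ℝ n (fun x => (Matrix.of.symm (B x) : MatSpace)) S) :
    ContDiffOn ℝ n (fun x => (Matrix.of.symm (A x * B x) : MatSpace)) S :=
  matMulL.isBoundedBilinearMap.contDiff.comp_contDiffOn (hA.prodMk hB)

theorem contDiffOn_transpose {A : E → M3}
    (hA : ContDiffOn ℝ n (fun x => (Matrix.of.symm (A x) : MatSpace)) S) :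
    ContDiffOn ℝ n (fun x => (Matrix.of.symm (A x)ᵀ : MatSpace)) S :=
  transposeL.contDiff.comp_contDiffOn hA

theorem contDiffOn_hat {f : E → E3} (hf : ContDiffOn ℝ n f S) :
    ContDiffOn ℝ n (fun x => (Matrix.of.symm (hat (f x)) : MatSpace)) S :=
  hatL.contDiff.comp_contDiffOn hf

theorem contDiffOn_vee {A : E → M3}
    (hA : ContDiffOn ℝ n (fun x => (Matrix.of.symm (A x) : MatSpace)) S) :
    ContDiffOn ℝ n (fun x => vee (A x)) S :=
  veeL.contDiff.comp_contDiffOn hA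

theorem contDiffOn_quatMat {f : E → E3} (hf : ContDiffOn ℝ n f S) (h : ∀ x ∈ S, ‖f x‖ < 1) :
    ContDiffOn ℝ n
      (fun x => (Matrix.of.symm (quatMat (√(1 - ‖f x‖ ^ 2)) (f x)) : MatSpace)) S := by
  have hq : ContDiffOn ℝ n (fun x => √(1 - ‖f x‖ ^ 2)) S :=
    (contDiffOn_const.sub (hf.norm_sq ℝ)).sqrt fun x hx =>
      (Real.sqrt_pos.1 (sqrt_pos_of_norm_lt (h x hx))).ne'
  exact ((contDiffOn_const (c := (Matrix.of.symm (1 : M3) : MatSpace))).add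
    ((contDiffOn_const.mul hq).smul (contDiffOn_hat hf))).add
    ((contDiffOn_const (c := (2 : ℝ))).smul
      (contDiffOn_mul (contDiffOn_hat hf) (contDiffOn_hat hf)))

variable {μ : E3}

theorem contDiffOn_sliceQuat (hμ : μ ≠ 0) : ContDiffOn ℝ n (sliceQuat μ) (sliceDomain μ) := by
  have h1 : ContDiffOn ℝ n (fun s : Slice μ => μ + (s.1 : E3)) (sliceDomain μ) :=
    contDiffOn_const.add (((isotropy μ).subtypeL.contDiff.comp contDiff_fst).contDiffOn)
  have hne : ∀ s ∈ sliceDomain μ, 0 < ‖μ + (s.1 : E3)‖ := fun s hs => norm_add_pos hμ hs.1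
  have hr : 0 < ‖μ‖ := norm_pos_iff.2 hμ
  have h2 : ContDiffOn ℝ n (fun s : Slice μ => √(‖μ‖ / ‖μ + (s.1 : E3)‖)) (sliceDomain μ) :=
    (contDiffOn_const.div (h1.norm ℝ fun s hs => norm_pos_iff.1 (hne s hs))
      fun s hs => (hne s hs).ne').sqrt fun s hs => (div_pos hr (hne s hs)).ne'
  exact (contDiffOn_const.mul h2).smul
    ((orbitInvL μ).contDiff.comp contDiff_snd).contDiffOn

theorem smoothOn_tube (hμ : μ ≠ 0) : SmoothOn (tube μ) (tubeDomain μ) := by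
  intro p hp
  -- No restriction on the matrix variable is needed: the formula is linear in it.
  refine ⟨Prod.snd ⁻¹' sliceDomain μ, (isOpen_sliceDomain hμ).preimage continuous_snd, hp, ?_⟩
  let R : MatSpace × Slice μ → M3 := fun x =>
    quatMat (√(1 - ‖sliceQuat μ x.2‖ ^ 2)) (sliceQuat μ x.2)
  have hR : ContDiffOn ℝ ∞ (fun x => (Matrix.of.symm (R x) : MatSpace))
      (Prod.snd ⁻¹' sliceDomain μ) :=
    contDiffOn_quatMat ((contDiffOn_sliceQuat hμ).comp contDiff_snd.contDiffOn fun _ h => h)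
      fun x hx => ((mem_sliceDomain_iff hμ _).1 hx).2
  have hM : ContDiffOn ℝ ∞ (fun x : MatSpace × Slice μ => μ + (x.2.1 : E3))
      (Prod.snd ⁻¹' sliceDomain μ) :=
    contDiffOn_const.add
      (((isotropy μ).subtypeL.contDiff.comp (contDiff_fst.comp contDiff_snd)).contDiffOn)
  refine ⟨fun x => (Matrix.of.symm (Matrix.of x.1 * (R x)ᵀ),
    vee (R x * hat (μ + x.2.1) * (R x)ᵀ)),
    (contDiffOn_mul (A := fun x => Matrix.of x.1) contDiff_fst.contDiffOn
      (contDiffOn_transpose hR)).prodMk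
    (contDiffOn_vee (contDiffOn_mul (contDiffOn_mul hR (contDiffOn_hat hM))
      (contDiffOn_transpose hR))), fun q hq _ => ?_⟩
  rw [tube_eq]
  simp only [emb, Submonoid.coe_mul, coe_inv, Ad_apply, coe_tubeRotation hμ hq, R]
  rfl

theorem contDiffOn_momentumQuat (hμ : μ ≠ 0) :
    ContDiffOn ℝ n (momentumQuat μ) (momentumDomain μ) := by
  have hr : 0 < ‖μ‖ := norm_pos_iff.2 hμ
  have hpos : ∀ m ∈ momentumDomain μ,
      0 < 2 * (‖μ‖ * ‖m‖) * (‖μ‖ * ‖m‖ + inner ℝ μ m) := fun m hm =>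
    mul_pos (mul_pos two_pos (mul_pos hr (norm_pos_of_mem hm))) hm
  have h1 : ContDiffOn ℝ n (fun m : E3 => ‖μ‖ * ‖m‖) (momentumDomain μ) :=
    contDiffOn_const.mul
      (contDiffOn_id.norm ℝ fun m hm => norm_pos_iff.1 (norm_pos_of_mem hm))
  have h2 : ContDiffOn ℝ n (fun m : E3 => (inner ℝ μ m : ℝ)) (momentumDomain μ) :=
    contDiffOn_const.inner ℝ contDiffOn_id
  exact ((((contDiffOn_const.mul h1).mul (h1.add h2)).sqrt fun m hm => (hpos m hm).ne').inv
    fun m hm => (Real.sqrt_pos.2 (hpos m hm)).ne').smul (bracketL μ).contDiff.contDiffOn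

theorem contDiffOn_momentumSlice (hμ : μ ≠ 0) :
    ContDiffOn ℝ n (momentumSlice μ) (momentumDomain μ) := by
  have hr : 0 < ‖μ‖ := norm_pos_iff.2 hμ
  have h1 : ContDiffOn ℝ n (fun m : E3 => ‖m‖) (momentumDomain μ) :=
    contDiffOn_id.norm ℝ fun m hm => norm_pos_iff.1 (norm_pos_of_mem hm)
  refine (((h1.sub contDiffOn_const).div_const _).smul contDiffOn_const).prodMk
    ((LinearMap.toContinuousLinearMap (orbitMap μ).rangeRestrict).contDiff.comp_contDiffOn
      ((contDiffOn_const.mul ((h1.div_const _).sqrt fun m hm => ?_)).smul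
        (contDiffOn_momentumQuat hμ)))
  exact (div_pos (norm_pos_of_mem hm) hr).ne'

theorem smoothOn_tubeInv (hμ : μ ≠ 0) : SmoothOn (tubeInv μ) (tube μ '' tubeDomain μ) := by
  rw [image_tube hμ]
  intro p hp
  refine ⟨Prod.snd ⁻¹' momentumDomain μ, isOpen_momentumDomain.preimage continuous_snd, hp, ?_⟩
  let R : MatSpace × E3 → M3 := fun x =>
    quatMat (√(1 - ‖momentumQuat μ x.2‖ ^ 2)) (momentumQuat μ x.2)
  have hR : ContDiffOn ℝ ∞ (fun x => (Matrix.of.symm (R x) : MatSpace))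
      (Prod.snd ⁻¹' momentumDomain μ) :=
    contDiffOn_quatMat ((contDiffOn_momentumQuat hμ).comp contDiff_snd.contDiffOn fun _ h => h)
      fun x hx => norm_momentumQuat_lt hμ hx
  refine ⟨fun x => (Matrix.of.symm (Matrix.of x.1 * R x), momentumSlice μ x.2),
    (contDiffOn_mul (A := fun x => Matrix.of x.1) contDiff_fst.contDiffOn hR).prodMk
    ((contDiffOn_momentumSlice hμ).comp contDiff_snd.contDiffOn fun _ h => h), fun q hq _ => ?_⟩
  simp only [emb, tubeInv, Submonoid.coe_mul, coe_tubeRotation hμ (momentumSlice_mem hμ hq),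
    sliceQuat_momentumSlice hμ hq, R]
  rfl

end Smooth


/-! ### Tangent maps -/

section Derivatives

variable {x : ℝ}

theorem hasDerivAt_mul {A B : ℝ → M3} {A' B' : M3}
    (hA : HasDerivAt (fun t => (Matrix.of.symm (A t) : MatSpace)) (Matrix.of.symm A') x)
    (hB : HasDerivAt (fun t => (Matrix.of.symm (B t) : MatSpace)) (Matrix.of.symm B') x) :
    HasDerivAt (fun t => (Matrix.of.symm (A t * B t) : MatSpace))
      (Matrix.of.symm (A x * B' + A' * B x)) x :=
  matMulL.hasDerivAt_of_bilinear (fun _ => hA) (fun _ => hB)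

theorem hasDerivAt_transpose {A : ℝ → M3} {A' : M3}
    (hA : HasDerivAt (fun t => (Matrix.of.symm (A t) : MatSpace)) (Matrix.of.symm A') x) :
    HasDerivAt (fun t => (Matrix.of.symm (A t)ᵀ : MatSpace)) (Matrix.of.symm A'ᵀ) x :=
  transposeL.hasFDerivAt.comp_hasDerivAt x hA

theorem hasDerivAt_hat {f : ℝ → E3} {f' : E3} (hf : HasDerivAt f f' x) :
    HasDerivAt (fun t => (Matrix.of.symm (hat (f t)) : MatSpace)) (Matrix.of.symm (hat f')) x :=
  hatL.hasFDerivAt.comp_hasDerivAt x hf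

theorem hasDerivAt_vee {A : ℝ → M3} {A' : M3}
    (hA : HasDerivAt (fun t => (Matrix.of.symm (A t) : MatSpace)) (Matrix.of.symm A') x) :
    HasDerivAt (fun t => vee (A t)) (vee A') x :=
  veeL.hasFDerivAt.comp_hasDerivAt x hA

theorem hasDerivAt_quatMat {q : ℝ → ℝ} {a : ℝ → E3} {q' : ℝ} {a' : E3}
    (hq : HasDerivAt q q' x) (ha : HasDerivAt a a' x) (h : q x ^ 2 + ‖a x‖ ^ 2 = 1)
    (h' : q x * q' + inner ℝ (a x) a' = 0) :
    HasDerivAt (fun t => (Matrix.of.symm (quatMat (q t) (a t)) : MatSpace))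
      (Matrix.of.symm (quatMat (q x) (a x) *
        hat ((2 : ℝ) • (q x • a' - q' • a x - bracket (a x) a')))) x := by
  rw [quatMat_mul_hat _ _ _ _ h h']
  refine (((hasDerivAt_const x (Matrix.of.symm (1 : M3) : MatSpace)).add
    ((hq.const_mul 2).smul (hasDerivAt_hat ha))).add
    ((hasDerivAt_mul (hasDerivAt_hat ha) (hasDerivAt_hat ha)).const_smul (2 : ℝ))).congr_deriv ?_
  change Matrix.of.symm (0 + ((2 * q x) • hat a' + (2 * q') • hat (a x)) +
    (2 : ℝ) • (hat (a x) * hat a' + hat a' * hat (a x))) = _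
  congr 1
  module

theorem hasDerivAt_Ad {g : ℝ → SO3} {ξ : E3} {m : ℝ → E3} {m' : E3}
    (hg : HasDerivAt (fun t => (Matrix.of.symm (g t : M3) : MatSpace))
      (Matrix.of.symm ((g x : M3) * hat ξ)) x) (hm : HasDerivAt m m' x) :
    HasDerivAt (fun t => Ad (g t) (m t)) (Ad (g x) (bracket ξ (m x) + m')) x := by
  refine (hasDerivAt_vee (hasDerivAt_mul (hasDerivAt_mul hg (hasDerivAt_hat hm))
    (hasDerivAt_transpose hg))).congr_deriv ?_
  rw [Ad_apply]
  congr 1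
  rw [map_add, hat_bracket, Matrix.transpose_mul, hat_transpose]
  noncomm_ring

theorem hasDerivAt_mul_inv {g R : ℝ → SO3} {ξ β : E3}
    (hg : HasDerivAt (fun t => (Matrix.of.symm (g t : M3) : MatSpace))
      (Matrix.of.symm ((g x : M3) * hat ξ)) x)
    (hR : HasDerivAt (fun t => (Matrix.of.symm (R t : M3) : MatSpace))
      (Matrix.of.symm ((R x : M3) * hat β)) x) :
    HasDerivAt (fun t => (Matrix.of.symm ((g t * (R t)⁻¹ : SO3) : M3) : MatSpace))
      (Matrix.of.symm (((g x * (R x)⁻¹ : SO3) : M3) * hat (Ad (R x) (ξ - β)))) x := by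
  refine (hasDerivAt_mul hg (hasDerivAt_transpose hR)).congr_deriv ?_
  congr 1
  rw [hat_Ad', Submonoid.coe_mul, coe_inv, Matrix.transpose_mul, hat_transpose, map_sub]
  calc _ = (g x : M3) * (hat ξ - hat β) * (R x : M3)ᵀ := by noncomm_ring
    -- Inserting `Rᵀ R = 1` moves `g Rᵀ` to the front and leaves a conjugate by `R`.
    _ = (g x : M3) * (((R x : M3)ᵀ * (R x : M3)) * (hat ξ - hat β)) * (R x : M3)ᵀ := by
      rw [transpose_mul_self, one_mul]
    _ = _ := by simp only [mul_assoc]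

theorem hasDerivAt_fst {E F : Type*} [NormedAddCommGroup E] [NormedSpace ℝ E]
    [NormedAddCommGroup F] [NormedSpace ℝ F] {f : ℝ → E × F} {f' : E × F}
    (h : HasDerivAt f f' x) : HasDerivAt (fun t => (f t).1) f'.1 x :=
  (ContinuousLinearMap.fst ℝ E F).hasFDerivAt.comp_hasDerivAt x h

theorem hasDerivAt_snd {E F : Type*} [NormedAddCommGroup E] [NormedSpace ℝ E]
    [NormedAddCommGroup F] [NormedSpace ℝ F] {f : ℝ → E × F} {f' : E × F}
    (h : HasDerivAt f f' x) : HasDerivAt (fun t => (f t).2) f'.2 x :=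
  (ContinuousLinearMap.snd ℝ E F).hasFDerivAt.comp_hasDerivAt x h

variable {V : Type*} [NormedAddCommGroup V] [NormedSpace ℝ V]

theorem HasVelocity.fst {c : ℝ → SO3 × V} {v : E3 × V} (h : HasVelocity c v) :
    HasDerivAt (fun t => (Matrix.of.symm ((c t).1 : M3) : MatSpace))
      (Matrix.of.symm (((c 0).1 : M3) * hat v.1)) 0 :=
  hasDerivAt_fst (F := V) h

theorem HasVelocity.snd {c : ℝ → SO3 × V} {v : E3 × V} (h : HasVelocity c v) :
    HasDerivAt (fun t => (c t).2) v.2 0 :=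
  hasDerivAt_snd (E := MatSpace) h

end Derivatives

/-! ### The tangent map of the tube -/

section Tangent

variable {μ : E3}

/-- The left-trivialised velocity of the rotation with unit quaternion `(q, a)`, as a function of
the velocity of `a`. -/
def quatVelocity (q : ℝ) (a : E3) : E3 →ₗ[ℝ] E3 :=
  (2 : ℝ) • (q • LinearMap.id + (q⁻¹ • (innerₗ E3 a)).smulRight a - ad a)

theorem quatVelocity_apply (q : ℝ) (a a' : E3) :
    quatVelocity q a a' =
      (2 : ℝ) • (q • a' - (-(q⁻¹ * inner ℝ a a')) • a - bracket a a') := by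
  rw [neg_smul, sub_neg_eq_add]; rfl

/-- The derivative of `sliceQuat`. -/
def sliceQuatDeriv (μ : E3) (s : Slice μ) : Slice μ →ₗ[ℝ] E3 :=
  (1 / 2 * √(‖μ‖ / ‖μ + s.1‖)) •
    ((orbitInvL μ : orbitTangent μ →ₗ[ℝ] E3).comp (LinearMap.snd ℝ _ _) -
      ((2 * ‖μ + (s.1 : E3)‖)⁻¹ •
        ((signedNormL μ : isotropy μ →ₗ[ℝ] ℝ).comp (LinearMap.fst ℝ _ _))).smulRight
        (orbitInv μ s.2))

theorem sliceQuatDeriv_apply (s w : Slice μ) :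
    sliceQuatDeriv μ s w = (1 / 2 * √(‖μ‖ / ‖μ + s.1‖)) •
      (orbitInv μ w.2 - ((2 * ‖μ + (s.1 : E3)‖)⁻¹ * signedNorm μ w.1) • orbitInv μ s.2) := rfl

theorem hasDerivAt_sliceQuat (hμ : μ ≠ 0) {s : ℝ → Slice μ} {s' : Slice μ} {x : ℝ}
    (hs : HasDerivAt s s' x) (hx : s x ∈ sliceDomain μ) :
    HasDerivAt (fun t => sliceQuat μ (s t)) (sliceQuatDeriv μ (s x) s') x := by
  have hr : 0 < ‖μ‖ := norm_pos_iff.2 hμ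
  have hk := norm_add_pos hμ hx.1
  have hev : ∀ᶠ t in 𝓝 x, s t ∈ sliceDomain μ :=
    hs.continuousAt.eventually ((isOpen_sliceDomain hμ).mem_nhds hx)
  have h1 : HasDerivAt (fun t => orbitInv μ (s t).2) (orbitInv μ s'.2) x :=
    (orbitInvL μ).hasFDerivAt.comp_hasDerivAt x (hasDerivAt_snd hs)
  have h2 : HasDerivAt (fun t => signedNorm μ (s t).1) (signedNorm μ s'.1) x :=
    (signedNormL μ).hasFDerivAt.comp_hasDerivAt x (hasDerivAt_fst hs)
  -- Near the base point the curve stays in `U`, where the norm is affine in `ν`.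
  have h3 : HasDerivAt (fun t => ‖μ + ((s t).1 : E3)‖) (signedNorm μ s'.1) x := by
    refine (h2.const_add ‖μ‖).congr_of_eventuallyEq ?_
    filter_upwards [hev] with t ht using norm_add_isotropy hμ _ ht.1
  have h4 := (((hasDerivAt_const x ‖μ‖).div h3 hk.ne').sqrt (div_pos hr hk).ne').const_mul (1 / 2)
  have h5 : √(‖μ‖ / ‖μ + ((s x).1 : E3)‖) ≠ 0 := (Real.sqrt_pos.2 (div_pos hr hk)).ne'
  have h6 := Real.sq_sqrt (div_pos hr hk).le
  -- For `f = √(‖μ‖/k)` with `k = ‖μ + ν‖`, `f' = -f k' / (2k)`.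
  have h7 : 1 / 2 * ((0 * ‖μ + ((s x).1 : E3)‖ - ‖μ‖ * signedNorm μ s'.1) /
      ‖μ + ((s x).1 : E3)‖ ^ 2 / (2 * √(‖μ‖ / ‖μ + ((s x).1 : E3)‖))) =
      -(1 / 2 * √(‖μ‖ / ‖μ + ((s x).1 : E3)‖) *
        ((2 * ‖μ + ((s x).1 : E3)‖)⁻¹ * signedNorm μ s'.1)) := by
    field_simp
    rw [h6]
    field_simp
    ring
  have h8 := h4.smul h1
  refine h8.congr_deriv (Eq.trans (congrArg₂ (· + ·) rfl (congrArg (· • orbitInv μ (s x).2) h7)) ?_)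
  rw [sliceQuatDeriv_apply]
  exact (show ∀ (f g : ℝ) (u w : E3), f • u + (-(f * g)) • w = f • (u - g • w) from
    fun f g u w => by module) _ _ _ _

/-- The linear map `(ξ, w) ↦ (Ad_R (ξ - β), Ad_R (β × M + ν'))`, where `β` depends linearly on
`w = (ν', ρ')`. -/
def rotatedTangent (R : SO3) (M : E3) (β : Slice μ →ₗ[ℝ] E3) : E3 × Slice μ →ₗ[ℝ] E3 × E3 :=
  ((Ad R).comp (LinearMap.fst ℝ _ _ - β.comp (LinearMap.snd ℝ _ _))).prod
    ((Ad R).comp (-(ad M).comp (β.comp (LinearMap.snd ℝ _ _)) +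
      (isotropy μ).subtype.comp ((LinearMap.fst ℝ _ _).comp (LinearMap.snd ℝ _ _))))

theorem rotatedTangent_apply (R : SO3) (M : E3) (β : Slice μ →ₗ[ℝ] E3) (v : E3 × Slice μ) :
    rotatedTangent R M β v =
      (Ad R (v.1 - β v.2), Ad R (bracket (β v.2) M + v.2.1)) := by
  rw [bracket_swap (β v.2)]; rfl

/-- The left-trivialised velocity of `F(ν, η)` as a function of the velocity of the slice
coordinates. -/
def tubeRotationVelocity (μ : E3) (s : Slice μ) : Slice μ →ₗ[ℝ] E3 :=
  (quatVelocity √(1 - ‖sliceQuat μ s‖ ^ 2) (sliceQuat μ s)).comp (sliceQuatDeriv μ s)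

theorem tubeRotationVelocity_apply (s w : Slice μ) :
    tubeRotationVelocity μ s w =
      quatVelocity √(1 - ‖sliceQuat μ s‖ ^ 2) (sliceQuat μ s) (sliceQuatDeriv μ s w) := rfl

/-- The left-trivialised tangent map of the tube at a point with slice coordinates `s`. -/
def tubeTangent (μ : E3) (s : Slice μ) : E3 × Slice μ →ₗ[ℝ] E3 × E3 :=
  rotatedTangent (tubeRotation μ s.1 (orbitInv μ s.2)) (μ + s.1) (tubeRotationVelocity μ s)

theorem hasTangentMapAt_tube (hμ : μ ≠ 0) {p : SO3 × Slice μ} (hp : p ∈ tubeDomain μ) :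
    HasTangentMapAt (tube μ) p (tubeTangent μ p.2) := by
  rintro c v rfl hc
  have hs : (c 0).2 ∈ sliceDomain μ := hp
  have h1 := ((mem_sliceDomain_iff hμ _).1 hs).2
  have hev : ∀ᶠ t in 𝓝 (0 : ℝ), (c t).2 ∈ sliceDomain μ :=
    hc.snd.continuousAt.eventually ((isOpen_sliceDomain hμ).mem_nhds hs)
  have hq := sqrt_pos_of_norm_lt h1
  have ha := hasDerivAt_sliceQuat hμ hc.snd hs
  -- From `q² + ‖a‖² = 1`: `q' = -⟨a, a'⟩ / q`.
  have hq' : HasDerivAt (fun t => √(1 - ‖sliceQuat μ (c t).2‖ ^ 2))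
      (-((√(1 - ‖sliceQuat μ (c 0).2‖ ^ 2))⁻¹ *
        inner ℝ (sliceQuat μ (c 0).2) (sliceQuatDeriv μ (c 0).2 v.2))) 0 := by
    refine ((ha.norm_sq.const_sub 1).sqrt (Real.sqrt_pos.1 hq).ne').congr_deriv ?_
    field_simp
  have hR : HasDerivAt
      (fun t => (Matrix.of.symm (tubeRotation μ (c t).2.1 (orbitInv μ (c t).2.2) : M3) : MatSpace))
      (Matrix.of.symm ((tubeRotation μ (c 0).2.1 (orbitInv μ (c 0).2.2) : M3) *
        hat (tubeRotationVelocity μ (c 0).2 v.2))) 0 := by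
    rw [coe_tubeRotation hμ hs, tubeRotationVelocity_apply, quatVelocity_apply]
    refine (hasDerivAt_quatMat hq' ha (sqrt_sq_add_sq h1) ?_).congr_of_eventuallyEq ?_
    · field_simp; ring
    · filter_upwards [hev] with t ht
      rw [coe_tubeRotation hμ ht]
  have hM : HasDerivAt (fun t => μ + ((c t).2.1 : E3)) (v.2.1 : E3) 0 :=
    ((isotropy μ).subtypeL.hasFDerivAt.comp_hasDerivAt 0 (hasDerivAt_fst hc.snd)).const_add μ
  rw [tubeTangent, rotatedTangent_apply, HasVelocity]
  simp only [tube_eq]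
  exact (hasDerivAt_mul_inv hc.fst hR).prodMk (hasDerivAt_Ad hR hM)

/-- The canonical form on the images of two vectors under a rotation of the body frame. -/
theorem canonicalForm_rotated (g R : SO3) (M ξ₁ ξ₂ β₁ β₂ ν₁ ν₂ : E3) :
    canonicalForm (g, Ad R M) (Ad R (ξ₁ - β₁), Ad R (bracket β₁ M + ν₁))
        (Ad R (ξ₂ - β₂), Ad R (bracket β₂ M + ν₂)) =
      inner ℝ M (bracket ξ₁ ξ₂) + inner ℝ ν₂ ξ₁ - inner ℝ ν₁ ξ₂ +
        (-inner ℝ M (bracket β₁ β₂) - inner ℝ ν₂ β₁ + inner ℝ ν₁ β₂) := by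
  rw [canonicalForm_eq]
  -- After `R` is removed by invariance, the terms mixing `ξ` and `β` cancel by cyclicity of the
  -- triple product.
  simp only [← Ad_bracket, inner_Ad_Ad]
  simp only [inner_eq, bracket_eq]
  simp
  ring

/-! ### Pullback of the canonical form -/

theorem inner_quatVelocity {q : ℝ} {a : E3} (b : E3) (ha : inner ℝ μ a = 0)
    (hb : inner ℝ μ b = 0) :
    inner ℝ μ (quatVelocity q a b) = -2 * inner ℝ μ (bracket a b) := by
  rw [quatVelocity_apply]
  simp only [inner_smul_right, inner_sub_right, ha, hb]
  ring

/-- The equal-area property. Expansion gives `4 q² ⟨μ, [b, c]⟩` and terms containing `q q⁻¹ = 1`;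
for `a ⟂ μ` the latter add up to `4 ‖a‖² ⟨μ, [b, c]⟩` by `hg`, and `q² + ‖a‖² = 1`. -/
theorem inner_bracket_quatVelocity {q : ℝ} {a b c : E3} (hq : q ≠ 0) (h : q ^ 2 + ‖a‖ ^ 2 = 1)
    (ha : inner ℝ μ a = 0) (hb : inner ℝ μ b = 0) (hc : inner ℝ μ c = 0) :
    inner ℝ μ (bracket (quatVelocity q a b) (quatVelocity q a c)) =
      4 * inner ℝ μ (bracket b c) := by
  have key : inner ℝ μ (bracket (quatVelocity q a b) (quatVelocity q a c)) =
      4 * (q ^ 2 * inner ℝ μ (bracket b c) +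
        (q * q⁻¹) * (inner ℝ a c * inner ℝ μ (bracket b a) +
          inner ℝ a b * inner ℝ μ (bracket a c)) +
        inner ℝ μ a * inner ℝ a (bracket b c)) +
      4 * (inner ℝ μ c * (inner ℝ a (quatVelocity q a b) / 2) -
        inner ℝ μ b * (inner ℝ a (quatVelocity q a c) / 2)) := by
    simp only [quatVelocity_apply, inner_eq, bracket_eq]
    simp
    ring
  have hg : ‖a‖ ^ 2 * inner ℝ μ (bracket b c) =
      inner ℝ a b * inner ℝ μ (bracket a c) - inner ℝ a c * inner ℝ μ (bracket a b) +
        inner ℝ a μ * inner ℝ a (bracket b c) := by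
    simp only [normSq_eq, inner_eq, bracket_eq]
    simp
    ring
  rw [ha, hb, hc, mul_inv_cancel₀ hq] at key
  rw [real_inner_comm μ a, ha, bracket_swap a b, inner_neg_right] at hg
  linear_combination key + 4 * inner ℝ μ (bracket b c) * h - 4 * hg

theorem pullback_identity (hμ : μ ≠ 0) {s : Slice μ} (hs : s ∈ sliceDomain μ) (v w : Slice μ) :
    -inner ℝ (μ + (s.1 : E3)) (bracket (tubeRotationVelocity μ s v) (tubeRotationVelocity μ s w)) -
        inner ℝ (w.1 : E3) (tubeRotationVelocity μ s v) +
        inner ℝ (v.1 : E3) (tubeRotationVelocity μ s w) =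
      -inner ℝ μ (bracket (orbitInv μ v.2) (orbitInv μ w.2)) := by
  have hr : 0 < ‖μ‖ := norm_pos_iff.2 hμ
  have hk := norm_add_pos hμ hs.1
  obtain ⟨h1, h2⟩ := (mem_sliceDomain_iff hμ s).1 hs
  have hd : ∀ w : Slice μ, inner ℝ μ (sliceQuatDeriv μ s w) = 0 := fun w => by
    rw [sliceQuatDeriv_apply, inner_smul_right, inner_sub_right, inner_smul_right,
      inner_orbitInv hμ, inner_orbitInv hμ, mul_zero, sub_zero, mul_zero]
  rw [inner_isotropy hμ, inner_isotropy hμ, tubeRotationVelocity_apply,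
    tubeRotationVelocity_apply, inner_quatVelocity _ (inner_sliceQuat hμ s) (hd _),
    inner_quatVelocity _ (inner_sliceQuat hμ s) (hd _), add_isotropy_eq hμ,
    ← norm_add_isotropy hμ _ h1, real_inner_smul_left,
    inner_bracket_quatVelocity (sqrt_pos_of_norm_lt h2).ne' (sqrt_sq_add_sq h2)
      (inner_sliceQuat hμ s) (hd _) (hd _), sliceQuatDeriv_apply, sliceQuatDeriv_apply, sliceQuat]
  have h3 := Real.sq_sqrt (div_pos hr hk).le
  set f := √(‖μ‖ / ‖μ + (s.1 : E3)‖)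
  set k := ‖μ + (s.1 : E3)‖
  -- This normalisation is the reason for the factor `√(‖μ‖/‖μ+ν‖)` in `F`. The contributions of the
  -- derivative of `f` cancel against the two terms with `ν'`.
  have h4 : f ^ 2 * k / ‖μ‖ = 1 := by rw [h3]; field_simp
  simp only [sub_eq_add_neg, ← neg_smul, bracket_smul_left, bracket_smul_right, bracket_add_left,
    bracket_add_right, inner_smul_right, inner_add_right, bracket_self, inner_zero_right]
  rw [bracket_swap (orbitInv μ v.2) (orbitInv μ s.2), inner_neg_right]
  field_simp
  field_simp at h4
  linear_combination (-16 * k * inner ℝ μ (bracket (orbitInv μ v.2) (orbitInv μ w.2))) * h4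

theorem modelForm_eq (p : SO3 × Slice μ) (v w : E3 × Slice μ) :
    modelForm μ p v w = inner ℝ (μ + (p.2.1 : E3)) (bracket v.1 w.1) + inner ℝ (w.2.1 : E3) v.1 -
      inner ℝ (v.2.1 : E3) w.1 - inner ℝ μ (bracket (orbitInv μ v.2.2) (orbitInv μ w.2.2)) := by
  have hproj : ∀ (ν : isotropy μ) (x : E3),
      inner ℝ (ν : E3) ((isotropy μ).starProjection x) = inner ℝ (ν : E3) x := fun ν x => by
    rw [← Submodule.inner_starProjection_left_eq_right,
      Submodule.starProjection_eq_self_iff.2 ν.2]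
  rw [modelForm, hproj, hproj, inner_add_left]
  ring

theorem pullback_tube (hμ : μ ≠ 0) :
    PullbackEqOn (tube μ) canonicalForm (modelForm μ) (tubeDomain μ) := by
  intro p hp
  refine ⟨tubeTangent μ p.2, hasTangentMapAt_tube hμ hp, fun v w => ?_⟩
  rw [tubeTangent, rotatedTangent_apply, rotatedTangent_apply, tube_eq, canonicalForm_rotated,
    pullback_identity hμ hp, modelForm_eq]
  ring

/-! ### Nondegeneracy and momentum map of the model form -/

theorem inner_bracket_bracket_self (x y : E3) :
    inner ℝ x (bracket y (bracket x y)) = ‖x‖ ^ 2 * ‖y‖ ^ 2 - inner ℝ x y ^ 2 := by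
  rw [bracket_bracket, inner_sub_right, inner_smul_right, inner_smul_right,
    real_inner_self_eq_norm_sq, real_inner_self_eq_norm_sq, real_inner_comm x y]
  ring

theorem modelForm_nondegenerate (hμ : μ ≠ 0) {p : SO3 × Slice μ} (hp : p ∈ tubeDomain μ)
    {v : E3 × Slice μ} (hv : ∀ w, modelForm μ p v w = 0) : v = 0 := by
  have hk := norm_add_pos hμ hp.1
  have h0 : ∀ x, bracket x 0 = 0 := fun x => (ad x).map_zero
  have hz : orbitInv μ 0 = 0 := (orbitInvL μ).map_zero
  have hρ : v.2.2 = 0 := by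
    -- Testing against the direction `μ × ζ`, where `ζ` is the orbit component of `v`, produces
    -- `‖μ‖² ‖ζ‖²` up to sign.
    obtain ⟨ρ, hρ⟩ : ∃ ρ, orbitInv μ ρ = bracket μ (orbitInv μ v.2.2) :=
      ⟨_, orbitInv_adStar μ hμ _ ((mem_isotropyPerp_iff hμ).2 (inner_self_bracket _ _))⟩
    have h1 := hv (0, 0, ρ)
    rw [modelForm_eq] at h1
    simp only [h0, hρ, inner_bracket_bracket_self, inner_orbitInv hμ] at h1
    have h2 : orbitInv μ v.2.2 = 0 := by simpa [hμ] using h1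
    rw [Subtype.ext_iff, ← (orbitInv_spec μ hμ v.2.2).2, h2, adStar_eq, h0]
    rfl
  have h1 : ∀ (ξ : E3) (ν : isotropy μ), inner ℝ (μ + (p.2.1 : E3)) (bracket v.1 ξ) +
      inner ℝ (ν : E3) v.1 - inner ℝ (v.2.1 : E3) ξ = 0 := fun ξ ν => by
    have := hv (ξ, ν, 0)
    rw [modelForm_eq] at this
    simpa [hz, h0] using this
  have hν : (v.2.1 : E3) = 0 := by
    -- Taking `ξ = ν'` leaves `‖ν'‖²`, since `μ + ν` and `ν'` are both multiples of `μ`.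
    have h2 := h1 v.2.1 0
    have h3 : inner ℝ (μ + (p.2.1 : E3)) (bracket v.1 (v.2.1 : E3)) = 0 := by
      rw [add_isotropy_eq hμ, isotropy_coe_eq hμ v.2.1, bracket_smul_right, inner_smul_right,
        real_inner_smul_left, inner_bracket_cycle, bracket_self, inner_zero_right, mul_zero,
        mul_zero]
    rw [h3] at h2
    simpa using h2
  have hξ : v.1 = 0 := by
    -- The test direction `μ` shows `v.1 ⟂ μ`; then `(μ + ν) × v.1` yields `‖μ + ν‖² ‖v.1‖² = 0`.
    have h2 := h1 0 ⟨μ, self_mem_isotropy μ⟩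
    have h3 := h1 (bracket (μ + (p.2.1 : E3)) v.1) 0
    have h4 : inner ℝ μ v.1 = 0 := by simpa [h0] using h2
    rw [inner_bracket_bracket_self, inner_add_left, inner_isotropy hμ, h4, hν] at h3
    simpa [hk.ne'] using h3
  exact Prod.ext hξ (Prod.ext (Subtype.ext hν) hρ)

/-- `J_Y` generates the left action: Hamilton's equation along a curve. -/
theorem hasDerivAt_modelMomentum {p : SO3 × Slice μ} (ξ : E3) {c : ℝ → SO3 × Slice μ}
    {v : E3 × Slice μ} (hp : c 0 = p) (hc : HasVelocity c v) :
    HasDerivAt (fun t => inner ℝ (modelMomentum μ (c t)) ξ)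
      (modelForm μ p (Ad p.1⁻¹ ξ, 0) v) 0 := by
  subst hp
  have hM : HasDerivAt (fun t => μ + ((c t).2.1 : E3)) (v.2.1 : E3) 0 :=
    ((isotropy μ).subtypeL.hasFDerivAt.comp_hasDerivAt 0 (hasDerivAt_fst hc.snd)).const_add μ
  simp only [modelMomentum, AdStar_inv]
  refine ((hasDerivAt_Ad hc.fst hM).inner ℝ (hasDerivAt_const 0 ξ)).congr_deriv ?_
  have hz : orbitInv μ 0 = 0 := (orbitInvL μ).map_zero
  -- With `x = Ad_{g⁻¹} ξ` and `M = μ + ν`, both sides are `⟨M, [x, v.1]⟩ + ⟨ν', x⟩`.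
  rw [modelForm_eq, inner_zero_right, zero_add, inner_Ad_left, inner_add_left,
    real_inner_comm, ← inner_bracket_cycle]
  have h0 : bracket 0 (orbitInv μ v.2.2) = 0 := by
    simpa using bracket_smul_left 0 0 (orbitInv μ v.2.2)
  simp [hz, h0]

end Tangent

end SO3

end
/-- For every nonzero `μ ∈ so(3)^*`, the explicit map `Φ = tube μ`, on the domain `SO(3) × U`, is an
`SO(3)`-equivariant diffeomorphism onto an open subset of `T^*SO(3) = SO(3) × so(3)^*`, it maps
`(e, 0, 0)` to `(e, μ)`, and `Φ^* Ω_c = Ω_Y`. The form `Ω_Y` is nondegenerate on the domain, and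
`J_Y(g, ν, ρ) = Ad*_{g⁻¹} (μ + ν)` is the momentum map of the left action of `SO(3)` for it. -/
theorem theorem2p3 (μ : E3) (hμ : μ ≠ 0) :
    -- the domain is an open neighbourhood of `SO(3) × {(0, 0)}`
    IsOpen (tubeDomain μ) ∧
    (∀ g : SO3, ((g, 0) : SO3 × Slice μ) ∈ tubeDomain μ) ∧
    -- the defining formula of `Φ`
    (∀ (g : SO3) (ν : isotropy μ) (η : E3) (_ : η ∈ isotropyPerp μ),
      tube μ (g, ν, ⟨adStar η μ, η, rfl⟩) =
        (g * (tubeRotation μ ν η)⁻¹, AdStar (tubeRotation μ ν η)⁻¹ (μ + ν))) ∧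
    -- base point and equivariance
    tube μ (1, 0) = (1, μ) ∧
    (∀ (h g : SO3) (s : Slice μ),
      tube μ (h * g, s) = (h * (tube μ (g, s)).1, (tube μ (g, s)).2)) ∧
    -- `Φ` is a diffeomorphism onto an open set
    SmoothOn (tube μ) (tubeDomain μ) ∧
    IsOpen (tube μ '' tubeDomain μ) ∧
    (∃ Ψ : SO3 × E3 → SO3 × Slice μ, SmoothOn Ψ (tube μ '' tubeDomain μ) ∧
      ∀ p ∈ tubeDomain μ, Ψ (tube μ p) = p) ∧
    -- `Φ` is symplectic
    PullbackEqOn (tube μ) canonicalForm (modelForm μ) (tubeDomain μ) ∧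
    (∀ p ∈ tubeDomain μ, ∀ v : E3 × Slice μ, (∀ w, modelForm μ p v w = 0) → v = 0) ∧
    -- the momentum map; `(Ad_{g⁻¹} ξ, 0)` is the left-trivialised infinitesimal action of `ξ`
    (∀ p ∈ tubeDomain μ, ∀ (ξ : E3) (c : ℝ → SO3 × Slice μ) (v : E3 × Slice μ),
      c 0 = p → HasVelocity c v →
        HasDerivAt (fun t => inner ℝ (modelMomentum μ (c t)) ξ)
          (modelForm μ p (Ad p.1⁻¹ ξ, 0) v) 0) :=
  ⟨isOpen_tubeDomain hμ, fun _ => zero_mem_sliceDomain hμ, tube_adStar hμ, tube_one_zero, tube_mul,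
    smoothOn_tube hμ, isOpen_image_tube hμ,
    ⟨tubeInv μ, smoothOn_tubeInv hμ, fun _ => tubeInv_tube hμ⟩, pullback_tube hμ,
    fun _ hp _ => modelForm_nondegenerate hμ hp, fun _ _ ξ _ _ => hasDerivAt_modelMomentum ξ⟩
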